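/- Let $X$ be a locally compact Polish space, $\mu$ a Radon measure on $X$, and $\mathrm{Conf}(X)$ the space of configurations $\xi=\sum_i\delta_{x_i}$ that are finite on compact sets, with the Borel $\sigma$-algebra of the vague topology. Let $K:X\times X\to M_2(\mathbb C)$ satisfy $K_{1,1}(x,y)=K_{2,2}(y,x)$, $K_{1,2}(x,y)=-K_{1,2}(y,x)$, $K_{2,1}(x,y)=-K_{2,1}(y,x)$, and put $Z=\begin{pmatrix}0&1\\-1&0\end{pmatrix}$, $\mathbb K=ZK$. Let $\mathbb P$ be a Pfaffian point process with kernel $\mathbb K$, i.e. a Borel probability measure on $\mathrm{Conf}(X)$ such that for every $k\ge1$ there is a locally integrable $\rho_k:X^k\to[0,\infty)$ with $\rho_k(x_1,\dots,x_k)=\mathrm{Pf}[\mathbb K(x_i,x_j)]_{i,j=1}^k$ for $\mu^{\otimes k}$-almost every $(x_1,\dots,x_k)$ and $$\mathbb E_{\mathbb P}\Big[\prod_{i=1}^m\xi(A_i)(\xi(A_i)-1)\cdots(\xi(A_i)-k_i+1)\Big]=\int_{A_1^{k_1}\times\cdots\times A_m^{k_m}}\rho_k\,d\mu^{\otimes k}$$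 for all $m\ge 1$, all pairwise disjoint compact $A_1,\dots,A_m\subset X$ and all integers $k_i\ge1$ with $k_1+\cdots+k_m=k$. Here $\mathrm{Pf}(R)=\frac1{2^kk!}\sum_{\sigma\in S_{2k}}\mathrm{sgn}(\sigma)\prod_{i=1}^kR_{\sigma(2i-1),\sigma(2i)}$. Let $f:X\to\mathbb R$ be bounded, measurable and compactly supported, and let $S_f(\xi)=\int_X f\,d\xi$. Let $n\ge1$, and suppose that for every $k\ge 1$ and every $(l_1,\dots,l_k)\in\mathbb N_+^k$ with $l_1+\cdots+l_k=n$ the function $$(x_1,\dots,x_k)\mapsto f^{l_1}(x_1)\cdots f^{l_k}(x_k)\,\mathrm{Tr}\big(K(x_1,x_2)K(x_2,x_3)\cdots K(x_k,x_1)\big)$$ is $\mu^{\otimes k}$-integrable, so that the integrals below exist. Then all moments of $S_f$ under $\mathbb P$ are finite, and its $n$-th cumulant $c_n(S_f)$, the coefficient of $(iz)^n/n!$ in the Taylor expansion of $\log\mathbb E_{\mathbb P}[\exp(izS_f)]$ at $z=0$, is $$c_n(S_f)=\frac12\sum_{\substack{k\ge1,\ (l_1,\dots,l_k)\in\mathbb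 N_+^k\\ l_1+\cdots+l_k=n}}(-1)^{k-1}\frac{n!}{l_1!\cdots l_k!}\cdot\frac1k\int_{X^k}f^{l_1}(x_1)\cdots f^{l_k}(x_k)\,\mathrm{Tr}\big(K(x_1,x_2)K(x_2,x_3)\cdots K(x_k,x_1)\big)\,d\mu(x_1)\cdots d\mu(x_k).$$ -/

import Mathlib

open MeasureTheory ProbabilityTheory Filter Topology
open scoped ENNReal CompactlySupported

noncomputable section

/-- The space of locally finite configurations on `X`: countable sums of Dirac masses (points may
be repeated) that are finite on compact sets. -/
structure Conf (X : Type*) [TopologicalSpace X] [MeasurableSpace X] where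
  /-- the configuration, as a measure on `X` -/
  toMeasure : Measure X
  exists_eq_sum_dirac : ∃ (ι : Type) (_ : Countable ι) (x : ι → X),
    toMeasure = Measure.sum fun i => Measure.dirac (x i)
  lt_top_of_isCompact : ∀ B : Set X, IsCompact B → toMeasure B < ∞

namespace Conf

variable {X : Type*} [TopologicalSpace X] [MeasurableSpace X]

/-- The vague topology: the coarsest topology that makes `ξ ↦ ∫ g dξ` continuous for every
continuous compactly supported `g : X → ℝ`. -/
instance : TopologicalSpace (Conf X) :=
  TopologicalSpace.induced (fun (ξ : Conf X) (g : C_c(X, ℝ)) => ∫ x, g x ∂ξ.toMeasure)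
    inferInstance

/-- The Borel σ-algebra of the vague topology. -/
instance : MeasurableSpace (Conf X) := borel (Conf X)

instance : BorelSpace (Conf X) := ⟨rfl⟩

/-- The number `#_A(ξ) = ξ(A)` of points of `ξ` in `A`, as a real number. -/
def count (A : Set X) (ξ : Conf X) : ℝ := ξ.toMeasure.real A

/-- The linear statistic `S_f(ξ) = ∫ f dξ`, the sum of `f` over the points of `ξ`. -/
def linearStatistic (f : X → ℝ) (ξ : Conf X) : ℝ := ∫ x, f x ∂ξ.toMeasure

theorem continuous_integral (g : C_c(X, ℝ)) :
    Continuous fun ξ : Conf X => ∫ x, g x ∂ξ.toMeasure := by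
  have h : Continuous fun (ξ : Conf X) (g : C_c(X, ℝ)) => ∫ x, g x ∂ξ.toMeasure :=
    continuous_induced_dom
  exact (continuous_apply g).comp h

instance (ξ : Conf X) : IsFiniteMeasureOnCompacts ξ.toMeasure :=
  ⟨fun {_} hB => ξ.lt_top_of_isCompact _ hB⟩

theorem measurable_apply_of_isCompact [PolishSpace X] [LocallyCompactSpace X] [BorelSpace X]
    {B : Set X} (hB : IsCompact B) : Measurable fun ξ : Conf X => ξ.toMeasure B := by
  refine UpperSemicontinuous.measurable ?_
  have h : (fun ξ : Conf X => ξ.toMeasure B) = fun ξ : Conf X =>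
      ⨅ (f : X → ℝ) (_ : Continuous f) (_ : HasCompactSupport f) (_ : Set.EqOn f 1 B)
      (_ : 0 ≤ f), ENNReal.ofReal (∫ x, f x ∂ξ.toMeasure) := by
    funext ξ
    let _ := TopologicalSpace.upgradeIsCompletelyMetrizable X
    have : IsLocallyFiniteMeasure ξ.toMeasure := inferInstance
    exact hB.measure_eq_biInf_integral_hasCompactSupport ξ.toMeasure
  rw [h]
  refine upperSemicontinuous_iInf fun f => upperSemicontinuous_iInf fun hf =>
    upperSemicontinuous_iInf fun hc => upperSemicontinuous_iInf fun _ =>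
    upperSemicontinuous_iInf fun _ => Continuous.upperSemicontinuous ?_
  exact ENNReal.continuous_ofReal.comp (continuous_integral ⟨⟨f, hf⟩, hc⟩)

/-- On a locally compact Polish space the numbers of points in Borel sets are Borel measurable
functions of the configuration. -/
theorem measurable_apply [PolishSpace X] [LocallyCompactSpace X] [BorelSpace X]
    {A : Set X} (hA : MeasurableSet A) : Measurable fun ξ : Conf X => ξ.toMeasure A := by
  have key : ∀ (n : ℕ) (A : Set X), MeasurableSet A →
      Measurable fun ξ : Conf X => ξ.toMeasure (A ∩ compactCovering X n) := by
    intro n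
    have hK := isCompact_compactCovering X n
    have hKm : MeasurableSet (compactCovering X n) := hK.measurableSet
    refine MeasurableSpace.induction_on_inter (s := {s : Set X | IsClosed s})
      (BorelSpace.measurable_eq.trans borel_eq_generateFrom_isClosed) isPiSystem_isClosed
      ?_ ?_ ?_ ?_
    · simp
    · intro t ht
      exact measurable_apply_of_isCompact (hK.inter_left ht)
    · intro t ht iht
      have h : (fun ξ : Conf X => ξ.toMeasure (tᶜ ∩ compactCovering X n)) = fun ξ : Conf X =>
          ξ.toMeasure (compactCovering X n) - ξ.toMeasure (t ∩ compactCovering X n) := by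
        funext ξ
        rw [← measure_sdiff Set.inter_subset_right (ht.inter hKm).nullMeasurableSet
          (ne_top_of_le_ne_top (ξ.lt_top_of_isCompact _ hK).ne
            (measure_mono Set.inter_subset_right))]
        congr 1
        ext x
        simp only [Set.mem_inter_iff, Set.mem_compl_iff, Set.mem_sdiff]
        tauto
      rw [h]
      exact (measurable_apply_of_isCompact hK).sub iht
    · intro g hd hg ihg
      have h : (fun ξ : Conf X => ξ.toMeasure ((⋃ i, g i) ∩ compactCovering X n)) =
          fun ξ : Conf X => ∑' i, ξ.toMeasure (g i ∩ compactCovering X n) := by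
        funext ξ
        rw [Set.iUnion_inter, measure_iUnion]
        · intro i j hij
          exact (hd hij).mono Set.inter_subset_left Set.inter_subset_left
        · intro i
          exact (hg i).inter hKm
      rw [h]
      exact Measurable.tsum ihg
  have h : (fun ξ : Conf X => ξ.toMeasure A) = fun ξ : Conf X =>
      ⨆ n, ξ.toMeasure (A ∩ compactCovering X n) := by
    funext ξ
    rw [← Monotone.measure_iUnion, ← Set.inter_iUnion, iUnion_compactCovering, Set.inter_univ]
    intro i j hij
    exact Set.inter_subset_inter_right _ (compactCovering_subset X hij)
  rw [h]
  exact Measurable.iSup fun n => key n A hA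

end Conf

/-- `ρ : X^k → [0, ∞)` is a `k`-th correlation function of the point process `P` with respect to
`μ`: it is locally integrable and, for pairwise disjoint compact `A₁, …, A_m` and positive
`k₁ + ⋯ + k_m = k`, the product of the falling factorials
`#_{A_i} (#_{A_i} - 1) ⋯ (#_{A_i} - k_i + 1)` has expectation
`∫ ρ dμ^k` over `A₁^{k₁} × ⋯ × A_m^{k_m}`. -/
structure IsCorrelationFunction {X : Type*} [TopologicalSpace X] [MeasurableSpace X]
    (P : Measure (Conf X)) (μ : Measure X) (k : ℕ) (ρ : (Fin k → X) → ℝ) : Prop where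
  nonneg : ∀ x, 0 ≤ ρ x
  locallyIntegrable : LocallyIntegrable ρ (Measure.pi fun _ : Fin k => μ)
  integrable_prod : ∀ (m : ℕ) (κ : Fin m → ℕ) (A : Fin m → Set X), 0 < m → (∀ i, 0 < κ i) →
    ∑ i, κ i = k → (∀ i, IsCompact (A i)) → (∀ i, MeasurableSet (A i)) →
    Pairwise (fun i j => Disjoint (A i) (A j)) →
    Integrable (fun ξ : Conf X => ∏ i, ∏ j ∈ Finset.range (κ i), (ξ.count (A i) - (j : ℝ))) P
  integral_prod : ∀ (m : ℕ) (κ : Fin m → ℕ) (A : Fin m → Set X), 0 < m → (∀ i, 0 < κ i) →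
    ∀ hk : ∑ i, κ i = k, (∀ i, IsCompact (A i)) → (∀ i, MeasurableSet (A i)) →
    Pairwise (fun i j => Disjoint (A i) (A j)) →
    ∫ ξ : Conf X, ∏ i, ∏ j ∈ Finset.range (κ i), (ξ.count (A i) - (j : ℝ)) ∂P =
      ∫ x in {x : Fin k → X | ∀ p : (i : Fin m) × Fin (κ i),
          x (Fin.cast hk (finSigmaFinEquiv p)) ∈ A p.1},
        ρ x ∂(Measure.pi fun _ : Fin k => μ)

/-- The Pfaffian of a `2n × 2n` matrix whose rows and columns `2i - 1, 2i` are labelled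
`(i, 0), (i, 1)`:
`Pf R = (1 / (2^n n!)) ∑_σ sgn σ ∏_i R_{σ(2i-1), σ(2i)}`. -/
def pfaffian {n : ℕ} (R : Matrix (Fin n × Fin 2) (Fin n × Fin 2) ℂ) : ℂ :=
  1 / ((2 : ℂ) ^ n * (n.factorial : ℂ)) *
    ∑ σ : Equiv.Perm (Fin n × Fin 2),
      ((Equiv.Perm.sign σ : ℤ) : ℂ) * ∏ i : Fin n, R (σ (i, 0)) (σ (i, 1))

/-- The matrix `Z`. -/
def pfaffianZ : Matrix (Fin 2) (Fin 2) ℂ := !![0, 1; -1, 0]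

/-- The `2k × 2k` matrix with `2 × 2` blocks `Z K(x_i, x_j)`. -/
def pfaffianMatrix {X : Type*} (K : X → X → Matrix (Fin 2) (Fin 2) ℂ) {k : ℕ} (x : Fin k → X) :
    Matrix (Fin k × Fin 2) (Fin k × Fin 2) ℂ :=
  Matrix.of fun p q => (pfaffianZ * K (x p.1) (x q.1)) p.2 q.2

/-- `P` is a Pfaffian point process with matrix kernel `Z K` with respect to `μ`. A correlation
function is only determined up to null sets, so the Pfaffian formula is required almost
everywhere. -/
structure IsPfaffianPointProcess {X : Type*} [TopologicalSpace X] [MeasurableSpace X]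
    (P : Measure (Conf X)) (μ : Measure X) (K : X → X → Matrix (Fin 2) (Fin 2) ℂ) : Prop where
  isProbabilityMeasure : IsProbabilityMeasure P
  symm_diag : ∀ x y, K x y 0 0 = K y x 1 1
  antisymm_upper : ∀ x y, K x y 0 1 = -K y x 0 1
  antisymm_lower : ∀ x y, K x y 1 0 = -K y x 1 0
  correlation : ∀ k : ℕ, 0 < k → ∃ ρ : (Fin k → X) → ℝ, IsCorrelationFunction P μ k ρ ∧
    ∀ᵐ x ∂(Measure.pi fun _ : Fin k => μ), (ρ x : ℂ) = pfaffian (pfaffianMatrix K x)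

/-- The `n`-th cumulant of a real random variable `η` with finite moments: the coefficient of
`(i z)^n / n!` in the Taylor expansion at `0` of `z ↦ log 𝔼[exp (i z η)]`. -/
def cumulant {Ω : Type*} [MeasurableSpace Ω] (P : Measure Ω) (η : Ω → ℝ) (n : ℕ) : ℂ :=
  iteratedDeriv n (fun z : ℝ => Complex.log (charFun (P.map η) z)) 0 / Complex.I ^ n

/-- `Tr (K(x₁, x₂) K(x₂, x₃) ⋯ K(x_k, x₁))`. -/
def cycleTrace {X : Type*} (K : X → X → Matrix (Fin 2) (Fin 2) ℂ) {k : ℕ} (x : Fin k → X) : ℂ :=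
  (List.ofFn fun i : Fin k => K (x i) (x (finRotate k i))).prod.trace

/-- `f^{l₁}(x₁) ⋯ f^{l_k}(x_k) Tr (K(x₁, x₂) ⋯ K(x_k, x₁))`. -/
def cumulantIntegrand {X : Type*} (f : X → ℝ) (K : X → X → Matrix (Fin 2) (Fin 2) ℂ) {k : ℕ}
    (l : Fin k → ℕ) (x : Fin k → X) : ℂ :=
  (∏ i, (f (x i) : ℂ) ^ l i) * cycleTrace K x

end

/-! Formally `E exp(t S_f) = E ∏ (1 + h(x))` over the points `x` of the configuration, with `h =
exp(t f) - 1`, and expanding the product gives `∑_k (1/k!) ∫ ∏ h(x_i) Pf[Z K(x_i, x_j)]`. Since `h`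
has no constant term in `t`, the coefficient of `t^n` involves only `k ≤ n`. The argument therefore
stays inside formal power series in `t` and needs no convergence of the generating function.

The algebraic core is an expansion of the Pfaffian around a marked point `z`: it is the sum, over
the ordered tuples of distinct other points, of half a signed trace of `K` around the cycle through
`z` and these points, times the Pfaffian of the points left over (`kernelPfaffian_cons_eq_sum`).
Repeated expansion along the first row follows a path `z → x_j → …`; the sign rules for the two
labels of each point produce the matrix `Z`, and `Z² = -1` produces the alternating sign.

Applying `t d/dt` to the moment series marks one point, by Leibniz and symmetry. With Fubini the
cycle expansion becomes `t M' = C M` (`eulerDeriv_momentSeries`), so `C` is the logarithmic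
derivative of `M` and its coefficients are the cumulants up to factorials
(`cumulant_eq_of_eulerDeriv_eq`). The factor `l_0` left by the marked point becomes `n/k` by
rotating the cycle (`sum_positiveTuples_rotate`), which gives the stated sum.

Integrability of a single trace is assumed only against the weights of total degree `n`. The
recursion therefore uses the cycle terms summed over all orders of their points; these are
integrable over compact sets because they are differences built from integrable Pfaffians
(`integrable_cyclePfaffian`). Single traces appear only when the `n`-th coefficient is extracted
(`coeff_cycleSeries`).

The correlation functions are tested on disjoint compact sets only. The moment formula is thus
proved first for step functions on such sets, and then for `f` by dominated convergence
(`integral_linearStatistic_pow`). -/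

noncomputable section

/-! ### Pfaffians -/

section Pfaffian

open Equiv Equiv.Perm

/-- The summand of `σ` in the Pfaffian. -/
def pfaffianTerm {n : ℕ} (R : Matrix (Fin n × Fin 2) (Fin n × Fin 2) ℂ)
    (σ : Perm (Fin n × Fin 2)) : ℂ :=
  ((sign σ : ℤ) : ℂ) * ∏ i : Fin n, R (σ (i, 0)) (σ (i, 1))

theorem pfaffian_eq_sum_pfaffianTerm {n : ℕ} (R : Matrix (Fin n × Fin 2) (Fin n × Fin 2) ℂ) :
    pfaffian R = 1 / ((2 : ℂ) ^ n * (n.factorial : ℂ)) * ∑ σ, pfaffianTerm R σ := rfl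

/-- The permutation of the pairs induced by a permutation of their labels. -/
def pairPerm {n : ℕ} (τ : Perm (Fin n)) : Perm (Fin n × Fin 2) := prodCongrLeft fun _ => τ

@[simp]
theorem pairPerm_apply {n : ℕ} (τ : Perm (Fin n)) (i : Fin n) (b : Fin 2) :
    pairPerm τ (i, b) = (τ i, b) := rfl

theorem sign_pairPerm {n : ℕ} (τ : Perm (Fin n)) : sign (pairPerm τ) = 1 := by
  rw [pairPerm, sign_prodCongrLeft, Fin.prod_univ_two]
  exact Int.units_mul_self _

theorem pfaffianTerm_mul_pairPerm {n : ℕ} (R : Matrix (Fin n × Fin 2) (Fin n × Fin 2) ℂ)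
    (σ : Perm (Fin n × Fin 2)) (τ : Perm (Fin n)) :
    pfaffianTerm R (σ * pairPerm τ) = pfaffianTerm R σ := by
  simp only [pfaffianTerm, Perm.sign_mul, sign_pairPerm, mul_one, Perm.mul_apply, pairPerm_apply]
  congr 1
  exact Equiv.prod_comp τ fun i => R (σ (i, 0)) (σ (i, 1))

theorem pfaffianTerm_mul_swap {n : ℕ} {R : Matrix (Fin n × Fin 2) (Fin n × Fin 2) ℂ}
    (hR : ∀ p q, R p q = -R q p) (σ : Perm (Fin n × Fin 2)) (i : Fin n) :
    pfaffianTerm R (σ * swap (i, 0) (i, 1)) = pfaffianTerm R σ := by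
  have hne : ((i, 0) : Fin n × Fin 2) ≠ (i, 1) := by simp
  simp only [pfaffianTerm, Perm.sign_mul, sign_swap hne, Perm.mul_apply]
  rw [← Finset.mul_prod_erase _ _ (Finset.mem_univ i),
    ← Finset.mul_prod_erase _ (fun i => R (σ (i, 0)) (σ (i, 1))) (Finset.mem_univ i)]
  rw [swap_apply_left, swap_apply_right, hR (σ (i, 1))]
  have : ∏ x ∈ Finset.univ.erase i, R (σ (swap (i, 0) (i, 1) (x, 0)))
      (σ (swap (i, 0) (i, 1) (x, 1))) = ∏ x ∈ Finset.univ.erase i, R (σ (x, 0)) (σ (x, 1)) := by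
    refine Finset.prod_congr rfl fun x hx => ?_
    have hx' := Finset.ne_of_mem_erase hx
    rw [swap_apply_of_ne_of_ne (by simp [hx']) (by simp [hx']),
      swap_apply_of_ne_of_ne (by simp [hx']) (by simp [hx'])]
  rw [this]
  push_cast
  ring

/-- The labels `(0, 0)` and `(0, 1)` as `none` and `some none`, before the remaining ones. -/
def splitFirstPair (n : ℕ) : Fin (n + 1) × Fin 2 ≃ Option (Option (Fin n × Fin 2)) where
  toFun p := Fin.cases (if p.2 = 0 then none else some none) (fun j => some (some (j, p.2))) p.1
  invFun o := o.elim (0, 0) fun o' => o'.elim (0, 1) fun p => (p.1.succ, p.2)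
  left_inv := by
    rintro ⟨i, b⟩
    refine Fin.cases ?_ (fun j => ?_) i
    · fin_cases b <;> rfl
    · rfl
  right_inv := by
    rintro (_ | _ | ⟨i, b⟩) <;> rfl

theorem splitFirstPair_symm_none (n : ℕ) : (splitFirstPair n).symm none = (0, 0) := rfl

theorem splitFirstPair_symm_some_none (n : ℕ) :
    (splitFirstPair n).symm (some none) = (0, 1) := rfl

theorem splitFirstPair_symm_some_some (n : ℕ) (p : Fin n × Fin 2) :
    (splitFirstPair n).symm (some (some p)) = (p.1.succ, p.2) := rfl

theorem splitFirstPair_zero_zero (n : ℕ) : splitFirstPair n (0, 0) = none := rfl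

theorem splitFirstPair_zero_one (n : ℕ) : splitFirstPair n (0, 1) = some none := rfl

theorem splitFirstPair_succ (n : ℕ) (i : Fin n) (b : Fin 2) :
    splitFirstPair n (i.succ, b) = some (some (i, b)) := rfl

/-- The permutation fixing `(0, 0)` with the given action on the remaining labels. -/
def fixFirst (n : ℕ) (π : Perm (Option (Fin n × Fin 2))) : Perm (Fin (n + 1) × Fin 2) :=
  (splitFirstPair n).symm.permCongr (optionCongr π)

theorem fixFirst_apply (n : ℕ) (π : Perm (Option (Fin n × Fin 2))) (p : Fin (n + 1) × Fin 2) :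
    fixFirst n π p = (splitFirstPair n).symm ((splitFirstPair n p).map π) := by
  simp [fixFirst, permCongr_apply]

theorem sign_fixFirst (n : ℕ) (π : Perm (Option (Fin n × Fin 2))) :
    sign (fixFirst n π) = sign π := by
  rw [fixFirst, sign_permCongr, optionCongr_sign]

theorem sum_perm_fix_first {n : ℕ} (t : Perm (Fin (n + 1) × Fin 2) → ℂ) :
    ∑ σ, (if σ (0, 0) = (0, 0) then t σ else 0) = ∑ π, t (fixFirst n π) := by
  rw [← Equiv.sum_comp ((decomposeOption.symm).trans (splitFirstPair n).symm.permCongr),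
    Fintype.sum_prod_type, Finset.sum_eq_single none]
  · refine Finset.sum_congr rfl fun π _ => ?_
    rw [if_pos]
    · congr 1
      ext1 p
      simp [fixFirst_apply, permCongr_apply]
    · simp [permCongr_apply, splitFirstPair_zero_zero, splitFirstPair_symm_none]
  · intro o _ ho
    refine Finset.sum_eq_zero fun π _ => if_neg ?_
    simp only [trans_apply, permCongr_apply, symm_symm, splitFirstPair_zero_zero,
      decomposeOption_symm_apply, Perm.mul_apply, optionCongr_apply, Option.map_none,
      swap_apply_left]
    rw [← splitFirstPair_symm_none, (splitFirstPair n).symm.apply_eq_iff_eq]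
    exact ho
  · simp

/-- Each permutation takes the value `(0, 0)` at exactly one of the `2(n + 1)` positions. Permuting
the pairs and flipping a pair leave the terms unchanged, so that position can be moved to `(0, 0)`.
-/
theorem sum_pfaffianTerm {n : ℕ} {R : Matrix (Fin (n + 1) × Fin 2) (Fin (n + 1) × Fin 2) ℂ}
    (hR : ∀ p q, R p q = -R q p) :
    ∑ σ, pfaffianTerm R σ = 2 * (n + 1 : ℂ) * ∑ π, pfaffianTerm R (fixFirst n π) := by
  have key : ∀ p : Fin (n + 1) × Fin 2,
      ∑ σ, (if σ p = (0, 0) then pfaffianTerm R σ else 0) =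
        ∑ σ, (if σ (0, 0) = (0, 0) then pfaffianTerm R σ else 0) := by
    rintro ⟨i, b⟩
    have h0 : ∑ σ, (if σ (i, b) = (0, 0) then pfaffianTerm R σ else 0) =
        ∑ σ, (if σ (i, 0) = (0, 0) then pfaffianTerm R σ else 0) := by
      fin_cases b
      · rfl
      · rw [← Equiv.sum_comp (Equiv.mulRight (swap (i, (0 : Fin 2)) (i, 1)))]
        refine Finset.sum_congr rfl fun σ _ => ?_
        simp only [coe_mulRight, pfaffianTerm_mul_swap hR, Perm.mul_apply]
        simp
    rw [h0, ← Equiv.sum_comp (Equiv.mulRight (pairPerm (swap 0 i)))]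
    refine Finset.sum_congr rfl fun σ _ => ?_
    simp only [coe_mulRight, pfaffianTerm_mul_pairPerm, Perm.mul_apply, pairPerm_apply,
      swap_apply_right]
  calc ∑ σ, pfaffianTerm R σ
      = ∑ σ, ∑ p, (if σ p = (0, 0) then pfaffianTerm R σ else 0) := by
        refine Finset.sum_congr rfl fun σ _ => ?_
        rw [Finset.sum_eq_single (σ.symm (0, 0))]
        · simp
        · intro p _ hp
          rw [if_neg]
          intro h
          exact hp (by simp [← h])
        · simp
    _ = ∑ p : Fin (n + 1) × Fin 2, ∑ π, pfaffianTerm R (fixFirst n π) := by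
        rw [Finset.sum_comm]
        refine Finset.sum_congr rfl fun p _ => ?_
        rw [key, sum_perm_fix_first]
    _ = _ := by
        simp [Finset.sum_const, Finset.card_univ, Fintype.card_prod, mul_comm]

/-- Here `q` is the partner of `(0, 0)`, with `none` standing for `(0, 1)`. If `q` is another label,
the transposition costs a sign, and `(0, 1)` takes the place of `q` among the remaining labels. -/
theorem pfaffianTerm_fixFirst {n : ℕ} (R : Matrix (Fin (n + 1) × Fin 2) (Fin (n + 1) × Fin 2) ℂ)
    (q : Option (Fin n × Fin 2)) (π : Perm (Fin n × Fin 2)) :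
    pfaffianTerm R (fixFirst n (decomposeOption.symm (q, π))) =
      (if q = none then 1 else -1) * R (0, 0) ((splitFirstPair n).symm (some q)) *
        pfaffianTerm (R.submatrix (fun p => (splitFirstPair n).symm (some (swap none q (some p))))
          (fun p => (splitFirstPair n).symm (some (swap none q (some p))))) π := by
  simp only [pfaffianTerm, sign_fixFirst, Fin.prod_univ_succ, fixFirst_apply,
    splitFirstPair_zero_zero, splitFirstPair_zero_one, splitFirstPair_succ,
    decomposeOption_symm_apply, Perm.sign_mul, optionCongr_sign, Option.map_none, Option.map_some,
    Perm.mul_apply, optionCongr_apply, swap_apply_left, splitFirstPair_symm_none,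
    Matrix.submatrix_apply]
  rcases q with _ | q
  · simp; ring
  · rw [sign_swap (by simp)]
    simp; ring

theorem splitFirstPair_symm_swap {n : ℕ} (q : Fin n × Fin 2) :
    (fun p => (splitFirstPair n).symm (some (swap none (some q) (some p)))) =
      Function.update (fun p : Fin n × Fin 2 => (p.1.succ, p.2)) q (0, 1) := by
  ext1 p
  by_cases h : p = q
  · subst h
    simp [splitFirstPair_symm_some_none]
  · rw [swap_apply_of_ne_of_ne (by simp) (by simpa using h), Function.update_of_ne h]
    rfl

/-- Expansion of the Pfaffian along its first row. -/
theorem pfaffian_succ {n : ℕ} {R : Matrix (Fin (n + 1) × Fin 2) (Fin (n + 1) × Fin 2) ℂ}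
    (hR : ∀ p q, R p q = -R q p) :
    pfaffian R = R (0, 0) (0, 1) * pfaffian (R.submatrix (fun p : Fin n × Fin 2 => (p.1.succ, p.2))
        (fun p => (p.1.succ, p.2))) -
      ∑ q : Fin n × Fin 2, R (0, 0) (q.1.succ, q.2) *
        pfaffian (R.submatrix
          (Function.update (fun p : Fin n × Fin 2 => (p.1.succ, p.2)) q (0, 1))
          (Function.update (fun p : Fin n × Fin 2 => (p.1.succ, p.2)) q (0, 1))) := by
  have h1 : ∑ π, pfaffianTerm R (fixFirst n π) =
      ∑ q : Option (Fin n × Fin 2), ∑ π, pfaffianTerm R (fixFirst n (decomposeOption.symm (q, π))) := by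
    rw [← Equiv.sum_comp decomposeOption.symm, Fintype.sum_prod_type]
  simp only [pfaffian_eq_sum_pfaffianTerm]
  rw [sum_pfaffianTerm hR, h1, Fintype.sum_option]
  simp only [pfaffianTerm_fixFirst, splitFirstPair_symm_swap, ← Finset.mul_sum]
  have hn : (n + 1 : ℂ) ≠ 0 := by exact_mod_cast Nat.succ_ne_zero n
  have h2 : ∀ S : ℂ, 1 / ((2 : ℂ) ^ (n + 1) * ((n + 1).factorial : ℂ)) * (2 * (n + 1 : ℂ) * S) =
      1 / (2 ^ n * (n.factorial : ℂ)) * S := by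
    intro S
    rw [Nat.factorial_succ]
    push_cast
    have : (n.factorial : ℂ) ≠ 0 := by exact_mod_cast n.factorial_ne_zero
    rw [pow_succ]
    field_simp
  rw [h2, mul_add, Finset.mul_sum Finset.univ _ (1 / _), sub_eq_add_neg,
    ← Finset.sum_neg_distrib]
  congr 1
  · simp only [if_true, one_mul, swap_self, Equiv.refl_apply, splitFirstPair_symm_some_none,
      splitFirstPair_symm_some_some]
    ring
  · refine Finset.sum_congr rfl fun q _ => ?_
    simp only [reduceCtorEq, if_false, splitFirstPair_symm_some_some]
    ring

theorem pfaffian_submatrix_pairPerm {n : ℕ} (R : Matrix (Fin n × Fin 2) (Fin n × Fin 2) ℂ)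
    (τ : Perm (Fin n)) : pfaffian (R.submatrix (pairPerm τ) (pairPerm τ)) = pfaffian R := by
  simp only [pfaffian_eq_sum_pfaffianTerm]
  congr 1
  rw [← Equiv.sum_comp (Equiv.mulLeft (pairPerm τ)) (pfaffianTerm R)]
  refine Finset.sum_congr rfl fun σ _ => ?_
  simp [pfaffianTerm, Perm.sign_mul, sign_pairPerm]

theorem pfaffian_submatrix_swap {n : ℕ} (R : Matrix (Fin n × Fin 2) (Fin n × Fin 2) ℂ)
    {p q : Fin n × Fin 2} (hpq : p ≠ q) :
    pfaffian (R.submatrix (swap p q) (swap p q)) = -pfaffian R := by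
  simp only [pfaffian_eq_sum_pfaffianTerm]
  rw [← mul_neg, ← Finset.sum_neg_distrib]
  congr 1
  rw [← Equiv.sum_comp (Equiv.mulLeft (swap p q)) fun σ => -pfaffianTerm R σ]
  refine Finset.sum_congr rfl fun σ _ => ?_
  simp [pfaffianTerm, Perm.sign_mul, sign_swap hpq]

theorem pfaffian_zero (R : Matrix (Fin 0 × Fin 2) (Fin 0 × Fin 2) ℂ) : pfaffian R = 1 := by
  simp [pfaffian]

end Pfaffian

/-! ### Expansion of the Pfaffian along paths and cycles -/

section PathExpansion

open Equiv Equiv.Perm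

variable {X : Type*} (K : X → X → Matrix (Fin 2) (Fin 2) ℂ)

/-- The Pfaffian `Pf [Z K(x_i, x_j)]`. -/
def kernelPfaffian {n : ℕ} (x : Fin n → X) : ℂ := pfaffian (pfaffianMatrix K x)

/-- The bilinear form `Z K` on labelled points. -/
def kernelForm (u v : X × Fin 2) : ℂ := (pfaffianZ * K u.1 v.1) u.2 v.2

/-- The Pfaffian of the form `Z K` on a family of pairs of labelled points. -/
def pairsPfaffian {n : ℕ} (w : Fin n × Fin 2 → X × Fin 2) : ℂ :=
  pfaffian (Matrix.of fun p q => kernelForm K (w p) (w q))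

/-- The pairs `(u, v), ((x_0, 0), (x_0, 1)), …`. -/
def consPair {n : ℕ} (u v : X × Fin 2) (x : Fin n → X) (p : Fin (n + 1) × Fin 2) : X × Fin 2 :=
  Fin.cases (if p.2 = 0 then u else v) (fun j => (x j, p.2)) p.1

theorem kernelPfaffian_eq_pairsPfaffian {n : ℕ} (x : Fin n → X) :
    kernelPfaffian K x = pairsPfaffian K fun p => (x p.1, p.2) := rfl

theorem kernelPfaffian_zero (x : Fin 0 → X) : kernelPfaffian K x = 1 := pfaffian_zero _

theorem pairsPfaffian_comp_pairPerm {n : ℕ} (w : Fin n × Fin 2 → X × Fin 2) (τ : Perm (Fin n)) :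
    pairsPfaffian K (fun p => w (pairPerm τ p)) = pairsPfaffian K w := by
  rw [pairsPfaffian, pairsPfaffian,
    ← pfaffian_submatrix_pairPerm (Matrix.of fun p q => kernelForm K (w p) (w q)) τ]
  congr 1

theorem kernelPfaffian_comp_perm {n : ℕ} (x : Fin n → X) (τ : Perm (Fin n)) :
    kernelPfaffian K (x ∘ τ) = kernelPfaffian K x :=
  pairsPfaffian_comp_pairPerm K (fun p => (x p.1, p.2)) τ

theorem kernelPfaffian_cons {n : ℕ} (z : X) (x : Fin n → X) :
    kernelPfaffian K (Fin.cons z x : Fin (n + 1) → X) =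
      pairsPfaffian K (consPair (z, 0) (z, 1) x) := by
  rw [kernelPfaffian_eq_pairsPfaffian]
  congr 1
  ext1 ⟨i, b⟩
  refine Fin.cases ?_ (fun j => ?_) i
  · fin_cases b <;> rfl
  · rfl

theorem pairsPfaffian_consPair_swap {n : ℕ} (u v : X × Fin 2) (x : Fin n → X) :
    pairsPfaffian K (consPair u v x) = -pairsPfaffian K (consPair v u x) := by
  rw [pairsPfaffian, pairsPfaffian, ← pfaffian_submatrix_swap _
    (show ((0, 0) : Fin (n + 1) × Fin 2) ≠ (0, 1) by simp)]
  have h : ∀ p : Fin (n + 1) × Fin 2,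
      consPair v u x (swap (0, 0) (0, 1) p) = consPair u v x p := by
    rintro ⟨i, b⟩
    refine Fin.cases ?_ (fun j => ?_) i
    · fin_cases b
      · rw [show ((0 : Fin (n + 1)), ((fun i => i) ⟨0, by norm_num⟩ : Fin 2)) = (0, 0) from rfl,
          swap_apply_left]
        rfl
      · rw [show ((0 : Fin (n + 1)), ((fun i => i) ⟨1, by norm_num⟩ : Fin 2)) = (0, 1) from rfl,
          swap_apply_right]
        rfl
    · rw [swap_apply_of_ne_of_ne (by simp) (by simp)]
      rfl
  congr 1
  ext p q
  simp [h]

variable {K}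

theorem pfaffianZ_mul_self : pfaffianZ * pfaffianZ = -1 := by
  ext i j
  fin_cases i <;> fin_cases j <;> simp [pfaffianZ]

theorem kernelForm_antisymm (h0 : ∀ x y, K x y 0 0 = K y x 1 1)
    (h1 : ∀ x y, K x y 0 1 = -K y x 0 1) (h2 : ∀ x y, K x y 1 0 = -K y x 1 0)
    (u v : X × Fin 2) : kernelForm K u v = -kernelForm K v u := by
  obtain ⟨x, a⟩ := u
  obtain ⟨y, b⟩ := v
  fin_cases a <;> fin_cases b <;>
    simp [kernelForm, pfaffianZ, Matrix.mul_apply, Fin.sum_univ_two, h0]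
  · rw [h2]
  · rw [h1]; simp

theorem pairsPfaffian_consPair (hA : ∀ u v, kernelForm K u v = -kernelForm K v u) {n : ℕ}
    (u v : X × Fin 2) (x : Fin n → X) :
    pairsPfaffian K (consPair u v x) = kernelForm K u v * kernelPfaffian K x -
      ∑ q : Fin n × Fin 2, kernelForm K u (x q.1, q.2) *
        pairsPfaffian K (Function.update (fun p => (x p.1, p.2)) q v) := by
  rw [pairsPfaffian, pfaffian_succ (R := Matrix.of _) (fun p q => by simpa using hA _ _)]
  refine congrArg₂ (· - ·) (congrArg₂ (· * ·) rfl (congrArg pfaffian ?_)) ?_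
  · ext p q
    rfl
  refine Finset.sum_congr rfl fun q _ => ?_
  congr 1
  rw [pairsPfaffian]
  congr 1
  have h : ∀ p : Fin n × Fin 2, consPair u v x
      (Function.update (fun p : Fin n × Fin 2 => (p.1.succ, p.2)) q (0, 1) p) =
        Function.update (fun p : Fin n × Fin 2 => (x p.1, p.2)) q v p := by
    intro p
    by_cases hp : p = q
    · subst hp; simp [consPair]
    · simp [Function.update_of_ne hp, consPair]
  ext p p'
  simp [h]

theorem pairsPfaffian_update_one {n : ℕ} (v : X × Fin 2) (x : Fin (n + 1) → X) (j : Fin (n + 1)) :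
    pairsPfaffian K (Function.update (fun p : Fin (n + 1) × Fin 2 => (x p.1, p.2)) (j, 1) v) =
      pairsPfaffian K (consPair (x j, 0) v fun i => x (swap 0 j i.succ)) := by
  rw [← pairsPfaffian_comp_pairPerm K _ (swap 0 j)]
  congr 1
  ext1 ⟨i, b⟩
  refine Fin.cases ?_ (fun i => ?_) i
  · fin_cases b <;> simp [consPair]
  · have : swap 0 j i.succ ≠ j := fun h => by
      rw [swap_apply_eq_iff, swap_apply_right] at h
      exact Fin.succ_ne_zero i h
    simp [consPair, this]

/-- Moving a pair to the front costs no sign, but here `v` sits in the first slot of its pair, and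
flipping the pair gives the minus sign. This asymmetry between the two labels is what produces
`pfaffianZ` in `openPfaffian_succ`. -/
theorem pairsPfaffian_update_zero {n : ℕ} (v : X × Fin 2) (x : Fin (n + 1) → X)
    (j : Fin (n + 1)) :
    pairsPfaffian K (Function.update (fun p : Fin (n + 1) × Fin 2 => (x p.1, p.2)) (j, 0) v) =
      -pairsPfaffian K (consPair (x j, 1) v fun i => x (swap 0 j i.succ)) := by
  rw [← pairsPfaffian_consPair_swap, ← pairsPfaffian_comp_pairPerm K _ (swap 0 j)]
  congr 1
  ext1 ⟨i, b⟩
  refine Fin.cases ?_ (fun i => ?_) i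
  · fin_cases b <;> simp [consPair]
  · have : swap 0 j i.succ ≠ j := fun h => by
      rw [swap_apply_eq_iff, swap_apply_right] at h
      exact Fin.succ_ne_zero i h
    simp [consPair, this]

variable (K)

/-- The Pfaffians with a first pair of labelled points over `y` and `z`, as a matrix in the labels
of this pair. -/
def openPfaffian {n : ℕ} (y z : X) (x : Fin n → X) : Matrix (Fin 2) (Fin 2) ℂ :=
  Matrix.of fun a b => pairsPfaffian K (consPair (y, a) (z, b) x)

variable {K}

theorem openPfaffian_zero (hA : ∀ u v, kernelForm K u v = -kernelForm K v u) (y z : X)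
    (x : Fin 0 → X) : openPfaffian K y z x = pfaffianZ * K y z := by
  ext a b
  simp [openPfaffian, pairsPfaffian_consPair hA, kernelPfaffian_zero, kernelForm]

/-- Expansion along the row of `(y, a)`: its partner is either the end label over `z` or one label
of some `x j`. In the second case the other label of `x j` becomes the new starting point, and
summing over the two labels with their signs is multiplication by `pfaffianZ`. -/
theorem openPfaffian_succ (hA : ∀ u v, kernelForm K u v = -kernelForm K v u) {n : ℕ} (y z : X)
    (x : Fin (n + 1) → X) : openPfaffian K y z x = kernelPfaffian K x • (pfaffianZ * K y z) +
      ∑ j, pfaffianZ * K y (x j) * pfaffianZ *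
        openPfaffian K (x j) z fun i => x (swap 0 j i.succ) := by
  ext a b
  simp only [openPfaffian, Matrix.of_apply, pairsPfaffian_consPair hA _ _ x,
    Fintype.sum_prod_type, Fin.sum_univ_two, pairsPfaffian_update_one, pairsPfaffian_update_zero,
    Matrix.add_apply, Matrix.sum_apply, Matrix.smul_apply, smul_eq_mul, sub_eq_add_neg]
  rw [← Finset.sum_neg_distrib]
  congr 1
  · rw [kernelForm]; ring
  · refine Finset.sum_congr rfl fun j _ => ?_
    rw [Matrix.mul_apply (M := pfaffianZ * K y (x j) * pfaffianZ),
      Fin.sum_univ_two, Matrix.mul_apply, Matrix.mul_apply, Fin.sum_univ_two, Fin.sum_univ_two]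
    simp only [kernelForm, Matrix.of_apply]
    simp [pfaffianZ]

variable (K)

/-- The product `K(y, u₁) K(u₁, u₂) ⋯ K(u_r, z)`. -/
def pathProd (z : X) : X → List X → Matrix (Fin 2) (Fin 2) ℂ
  | y, [] => K y z
  | y, u :: L => K y u * pathProd z u L

/-- The Pfaffian `Pf [Z K(x_i, x_j)]` of the points of a list. -/
def listPfaffian (L : List X) : ℂ := kernelPfaffian K L.get

theorem listPfaffian_ofFn {n : ℕ} (x : Fin n → X) :
    listPfaffian K (List.ofFn x) = kernelPfaffian K x := by
  have h : ∀ (L : List X) (n : ℕ) (hn : n = L.length),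
      listPfaffian K L = kernelPfaffian K fun i : Fin n => L.get (i.cast hn) := by
    rintro L n rfl
    rfl
  rw [h _ n (List.length_ofFn).symm]
  congr 1
  ext1 i
  simp

/-- The expansion of `openPfaffian` into paths from `y` to `z`. -/
def pathSum {n : ℕ} (y z : X) (x : Fin n → X) : Matrix (Fin 2) (Fin 2) ℂ :=
  ∑ r ∈ Finset.range (n + 1), ((-1 : ℂ) ^ r / ((n - r).factorial : ℂ)) •
    ∑ τ : Perm (Fin n), listPfaffian K ((List.ofFn (x ∘ τ)).drop r) •
      pathProd K z y ((List.ofFn (x ∘ τ)).take r)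

/-- The term `r = 0` is the direct step from `y` to `z`, where the orders of the unused points
cancel the factorial. The other terms are grouped by the first intermediate point, the component `j`
of `decomposeFin`. -/
theorem pathSum_succ {n : ℕ} (y z : X) (x : Fin (n + 1) → X) :
    pathSum K y z x = kernelPfaffian K x • K y z -
      ∑ j, K y (x j) * pathSum K (x j) z fun i => x (swap 0 j i.succ) := by
  rw [pathSum, Finset.sum_range_succ', add_comm, sub_eq_add_neg]
  congr 1
  · simp only [List.drop_zero, List.take_zero, listPfaffian_ofFn, kernelPfaffian_comp_perm,
      pathProd, Finset.sum_const, Finset.card_univ, Fintype.card_perm, Fintype.card_fin,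
      pow_zero, Nat.sub_zero]
    have : ((n + 1).factorial : ℂ) ≠ 0 := by exact_mod_cast (n + 1).factorial_ne_zero
    rw [← Nat.cast_smul_eq_nsmul ℂ, smul_smul, one_div, inv_mul_cancel₀ this, one_smul]
  · simp only [pathSum, Finset.mul_sum]
    rw [Finset.sum_comm, ← Finset.sum_neg_distrib]
    refine Finset.sum_congr rfl fun r _ => ?_
    rw [← Equiv.sum_comp decomposeFin.symm, Fintype.sum_prod_type, Finset.smul_sum,
      ← Finset.sum_neg_distrib]
    refine Finset.sum_congr rfl fun j _ => ?_
    rw [Matrix.mul_smul, ← neg_smul, Finset.mul_sum, Nat.add_sub_add_right, pow_succ]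
    congr 1
    · ring
    · refine Finset.sum_congr rfl fun e _ => ?_
      rw [List.ofFn_succ, List.drop_succ_cons, List.take_succ_cons, pathProd, Matrix.mul_smul]
      simp [Function.comp_def]

variable {K}

theorem openPfaffian_eq_pathSum (hA : ∀ u v, kernelForm K u v = -kernelForm K v u) {n : ℕ} :
    ∀ (y z : X) (x : Fin n → X), openPfaffian K y z x = pfaffianZ * pathSum K y z x := by
  induction n with
  | zero =>
    intro y z x
    rw [openPfaffian_zero hA]
    have : listPfaffian K [] = 1 := pfaffian_zero _
    simp [pathSum, pathProd, this]
  | succ n ih =>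
    intro y z x
    rw [openPfaffian_succ hA, pathSum_succ, mul_sub, Matrix.mul_smul, sub_eq_add_neg,
      Finset.mul_sum, ← Finset.sum_neg_distrib]
    congr 1
    refine Finset.sum_congr rfl fun j _ => ?_
    -- The two adjacent factors `pfaffianZ` give `-1`, the sign attached to each step of a path.
    rw [ih, mul_assoc (pfaffianZ * _), ← mul_assoc pfaffianZ pfaffianZ, pfaffianZ_mul_self]
    simp [mul_assoc]

/-- Expansion of the Pfaffian over the cycle that contains the first point. -/
theorem kernelPfaffian_cons_eq_sum (hA : ∀ u v, kernelForm K u v = -kernelForm K v u) {n : ℕ}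
    (z : X) (x : Fin n → X) : kernelPfaffian K (Fin.cons z x : Fin (n + 1) → X) =
      ∑ r ∈ Finset.range (n + 1), (-1 : ℂ) ^ r / ((n - r).factorial : ℂ) *
        ∑ τ : Perm (Fin n), 1 / 2 * (pathProd K z z ((List.ofFn (x ∘ τ)).take r)).trace *
          listPfaffian K ((List.ofFn (x ∘ τ)).drop r) := by
  have h1 : kernelPfaffian K (Fin.cons z x : Fin (n + 1) → X) = pathSum K z z x 1 1 := by
    rw [kernelPfaffian_cons]
    have := congr_fun (congr_fun (openPfaffian_eq_pathSum hA z z x) 0) 1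
    simpa [openPfaffian, pfaffianZ, Matrix.mul_apply, Fin.sum_univ_two] using this
  have h2 : kernelPfaffian K (Fin.cons z x : Fin (n + 1) → X) = pathSum K z z x 0 0 := by
    rw [kernelPfaffian_cons, pairsPfaffian_consPair_swap]
    have := congr_fun (congr_fun (openPfaffian_eq_pathSum hA z z x) 1) 0
    simp [openPfaffian, pfaffianZ, Matrix.mul_apply, Fin.sum_univ_two] at this
    rw [this, neg_neg]
  -- Reading the marked pair in either order shows that both diagonal entries of `pathSum` equal the
  -- Pfaffian. Their average is half the trace, the source of the factor `1/2` in the cumulant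
  -- formula.
  have h3 : kernelPfaffian K (Fin.cons z x : Fin (n + 1) → X) =
      1 / 2 * (pathSum K z z x).trace := by
    rw [Matrix.trace_fin_two, ← h1, ← h2]
    ring
  rw [h3, pathSum, Matrix.trace_sum, Finset.mul_sum]
  refine Finset.sum_congr rfl fun r _ => ?_
  rw [Matrix.trace_smul, Matrix.trace_sum, smul_eq_mul, mul_left_comm, Finset.mul_sum]
  congr 1
  refine Finset.sum_congr rfl fun τ _ => ?_
  rw [Matrix.trace_smul, smul_eq_mul]
  ring

end PathExpansion

/-! ### Measure-preserving rearrangements of coordinates -/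

section PiMaps

variable {X : Type*} [MeasurableSpace X] (ν : Measure X) [SigmaFinite ν]

/-- Reindexing the coordinates, as a measurable equivalence. -/
def reindexEquiv {ι ι' : Type*} (e : ι' ≃ ι) : (ι → X) ≃ᵐ (ι' → X) :=
  MeasurableEquiv.piCongrLeft (fun _ => X) e.symm

theorem reindexEquiv_apply {ι ι' : Type*} (e : ι' ≃ ι) (x : ι → X) :
    reindexEquiv e x = x ∘ e := by
  ext i
  obtain ⟨i, rfl⟩ := e.symm.surjective i
  rw [reindexEquiv, MeasurableEquiv.coe_piCongrLeft, Equiv.piCongrLeft_apply_apply]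
  simp

theorem measurePreserving_reindexEquiv {ι ι' : Type*} [Fintype ι] [Fintype ι'] (e : ι' ≃ ι) :
    MeasurePreserving (reindexEquiv e : (ι → X) ≃ᵐ (ι' → X)) (Measure.pi fun _ => ν)
      (Measure.pi fun _ => ν) :=
  measurePreserving_piCongrLeft (fun _ => ν) e.symm

/-- `Fin.cons` as a measurable equivalence. -/
def consEquiv (n : ℕ) : X × (Fin n → X) ≃ᵐ (Fin (n + 1) → X) :=
  (MeasurableEquiv.piFinSuccAbove (fun _ => X) 0).symm

theorem consEquiv_apply {n : ℕ} (p : X × (Fin n → X)) :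
    consEquiv n p = (Fin.cons p.1 p.2 : Fin (n + 1) → X) := by
  ext i
  refine Fin.cases ?_ (fun i => ?_) i <;> simp [consEquiv]

theorem measurePreserving_consEquiv (n : ℕ) :
    MeasurePreserving (consEquiv n) (ν.prod (Measure.pi fun _ => ν)) (Measure.pi fun _ => ν) :=
  (measurePreserving_piFinSuccAbove (fun _ : Fin (n + 1) => ν) 0).symm

/-- `Fin.append` as a measurable equivalence. -/
def appendEquiv (r s : ℕ) : (Fin r → X) × (Fin s → X) ≃ᵐ (Fin (r + s) → X) :=
  (MeasurableEquiv.sumPiEquivProdPi fun _ => X).symm.trans (reindexEquiv finSumFinEquiv.symm)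

theorem appendEquiv_apply {r s : ℕ} (p : (Fin r → X) × (Fin s → X)) :
    appendEquiv r s p = Fin.append p.1 p.2 := by
  ext i
  rw [appendEquiv, MeasurableEquiv.trans_apply, reindexEquiv_apply]
  refine Fin.addCases (fun i => ?_) (fun i => ?_) i <;>
    simp [MeasurableEquiv.coe_sumPiEquivProdPi_symm]

theorem measurePreserving_appendEquiv (r s : ℕ) :
    MeasurePreserving (appendEquiv r s) ((Measure.pi fun _ => ν).prod (Measure.pi fun _ => ν))
      (Measure.pi fun _ => ν) :=
  (measurePreserving_sumPiEquivProdPi_symm (X := fun _ : Fin r ⊕ Fin s => X) fun _ => ν).trans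
    (measurePreserving_reindexEquiv ν finSumFinEquiv.symm)

end PiMaps

/-! ### Coefficientwise integration of power series and the operator `t d/dt` -/

section CoefficientIntegrals

open PowerSeries

/-- All coefficients of the family of power series are bounded measurable functions. -/
def BoundedCoeffs {α : Type*} [MeasurableSpace α] (F : α → ℂ⟦X⟧) : Prop :=
  ∀ n, Measurable (fun x => coeff n (F x)) ∧ ∃ C : ℝ, ∀ x, ‖coeff n (F x)‖ ≤ C

namespace BoundedCoeffs

variable {α β : Type*} [MeasurableSpace α] [MeasurableSpace β] {F G : α → ℂ⟦X⟧}

theorem one : BoundedCoeffs fun _ : α => (1 : ℂ⟦X⟧) :=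
  fun _ => ⟨measurable_const, _, fun _ => le_rfl⟩

theorem mul (hF : BoundedCoeffs F) (hG : BoundedCoeffs G) :
    BoundedCoeffs fun x => F x * G x := by
  intro n
  choose hFm C hC using hF
  choose hGm D hD using hG
  simp only [coeff_mul]
  refine ⟨Finset.measurable_fun_sum _ fun p _ => (hFm p.1).mul (hGm p.2),
    ∑ p ∈ Finset.HasAntidiagonal.antidiagonal n, C p.1 * D p.2, fun x => ?_⟩
  refine (norm_sum_le _ _).trans (Finset.sum_le_sum fun p _ => ?_)
  rw [norm_mul]
  exact mul_le_mul (hC _ _) (hD _ _) (norm_nonneg _) ((norm_nonneg _).trans (hC p.1 x))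

theorem comp (hF : BoundedCoeffs F) {g : β → α} (hg : Measurable g) :
    BoundedCoeffs fun y => F (g y) := fun n =>
  ⟨(hF n).1.comp hg, (hF n).2.imp fun _ hC y => hC (g y)⟩

theorem prod {ι : Type*} (s : Finset ι) {F : ι → α → ℂ⟦X⟧} (hF : ∀ i, BoundedCoeffs (F i)) :
    BoundedCoeffs fun x => ∏ i ∈ s, F i x := by
  classical
  induction s using Finset.induction_on with
  | empty => simpa using one
  | insert i s hi ih =>
    simp only [Finset.prod_insert hi]
    exact (hF i).mul ih

theorem integrable_mul (hF : BoundedCoeffs F) {μ : Measure α} {g : α → ℂ} (hg : Integrable g μ)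
    (n : ℕ) : Integrable (fun x => coeff n (F x) * g x) μ := by
  obtain ⟨hm, C, hC⟩ := hF n
  exact hg.bdd_mul hm.aestronglyMeasurable (ae_of_all _ hC)

end BoundedCoeffs

/-- The power series of the integrals of the coefficients of `F` against `g`. -/
def coeffIntegral {α : Type*} [MeasurableSpace α] (μ : Measure α) (F : α → ℂ⟦X⟧) (g : α → ℂ) :
    ℂ⟦X⟧ := PowerSeries.mk fun n => ∫ x, coeff n (F x) * g x ∂μ

@[simp]
theorem coeff_coeffIntegral {α : Type*} [MeasurableSpace α] (μ : Measure α) (F : α → ℂ⟦X⟧)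
    (g : α → ℂ) (n : ℕ) : coeff n (coeffIntegral μ F g) = ∫ x, coeff n (F x) * g x ∂μ :=
  coeff_mk _ _

theorem coeffIntegral_prod_mul {α β : Type*} [MeasurableSpace α] [MeasurableSpace β]
    {μ : Measure α} {ν : Measure β} [SFinite μ] [SFinite ν] {F : α → ℂ⟦X⟧} {G : β → ℂ⟦X⟧}
    (hF : BoundedCoeffs F) (hG : BoundedCoeffs G) {f : α → ℂ} {g : β → ℂ} (hf : Integrable f μ)
    (hg : Integrable g ν) :
    coeffIntegral (μ.prod ν) (fun p => F p.1 * G p.2) (fun p => f p.1 * g p.2) =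
      coeffIntegral μ F f * coeffIntegral ν G g := by
  ext n
  simp only [coeff_coeffIntegral, coeff_mul, Finset.sum_mul]
  rw [integral_finsetSum]
  · refine Finset.sum_congr rfl fun q _ => ?_
    rw [← integral_prod_mul]
    congr 1
    ext p
    ring
  · intro q _
    refine ((hF.integrable_mul hf q.1).mul_prod (hG.integrable_mul hg q.2)).congr
      (ae_of_all _ fun p => ?_)
    simp only
    ring

theorem coeffIntegral_comp {α β : Type*} [MeasurableSpace α] [MeasurableSpace β]
    {μ : Measure α} {ν : Measure β} {e : α ≃ᵐ β} (he : MeasurePreserving e μ ν) (F : β → ℂ⟦X⟧)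
    (g : β → ℂ) :
    coeffIntegral μ (fun x => F (e x)) (fun x => g (e x)) = coeffIntegral ν F g := by
  ext n
  simp only [coeff_coeffIntegral]
  exact he.integral_comp' fun y => coeff n (F y) * g y

theorem coeffIntegral_sum {α ι : Type*} [MeasurableSpace α] {μ : Measure α} {F : α → ℂ⟦X⟧}
    (hF : BoundedCoeffs F) (s : Finset ι) (c : ι → ℂ) {g : ι → α → ℂ}
    (hg : ∀ i ∈ s, Integrable (g i) μ) :
    coeffIntegral μ F (fun x => ∑ i ∈ s, c i * g i x) =
      ∑ i ∈ s, c i • coeffIntegral μ F (g i) := by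
  ext n
  simp only [coeff_coeffIntegral, map_sum, coeff_smul, smul_eq_mul, Finset.mul_sum]
  rw [integral_finsetSum]
  · refine Finset.sum_congr rfl fun i _ => ?_
    rw [← integral_const_mul]
    congr 1
    ext x
    ring
  · intro i hi
    refine ((hF.integrable_mul (hg i hi) n).const_mul (c i)).congr (ae_of_all _ fun p => ?_)
    simp only
    ring

theorem X_pow_dvd_coeffIntegral {α : Type*} [MeasurableSpace α] {μ : Measure α} {F : α → ℂ⟦X⟧}
    {g : α → ℂ} {k : ℕ} (h : ∀ x, (PowerSeries.X : ℂ⟦X⟧) ^ k ∣ F x) :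
    (PowerSeries.X : ℂ⟦X⟧) ^ k ∣ coeffIntegral μ F g := by
  rw [PowerSeries.X_pow_dvd_iff]
  intro m hm
  rw [coeff_coeffIntegral]
  refine (integral_congr_ae (ae_of_all _ fun x => ?_)).trans (integral_zero _ _)
  rw [PowerSeries.X_pow_dvd_iff.1 (h x) m hm, zero_mul]

/-- The derivation `t d/dt` of power series. -/
def eulerDeriv (F : ℂ⟦X⟧) : ℂ⟦X⟧ := PowerSeries.X * PowerSeries.derivative ℂ F

@[simp]
theorem coeff_eulerDeriv (F : ℂ⟦X⟧) (n : ℕ) : coeff n (eulerDeriv F) = n * coeff n F := by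
  cases n with
  | zero => simp [eulerDeriv]
  | succ n =>
    rw [eulerDeriv, coeff_succ_X_mul, coeff_derivative]
    push_cast
    ring

theorem eulerDeriv_mul (F G : ℂ⟦X⟧) :
    eulerDeriv (F * G) = eulerDeriv F * G + F * eulerDeriv G := by
  simp only [eulerDeriv, Derivation.leibniz, smul_eq_mul]
  ring

theorem eulerDeriv_prod {ι : Type*} [DecidableEq ι] (s : Finset ι) (F : ι → ℂ⟦X⟧) :
    eulerDeriv (∏ i ∈ s, F i) = ∑ i ∈ s, eulerDeriv (F i) * ∏ j ∈ s.erase i, F j := by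
  induction s using Finset.induction_on with
  | empty => simp [eulerDeriv]
  | insert a s ha ih =>
    rw [Finset.prod_insert ha, eulerDeriv_mul, ih, Finset.sum_insert ha, Finset.erase_insert ha,
      Finset.mul_sum]
    congr 1
    refine Finset.sum_congr rfl fun i hi => ?_
    have hia : i ≠ a := fun h => ha (h ▸ hi)
    rw [Finset.erase_insert_of_ne hia.symm, Finset.prod_insert fun h => ha (Finset.mem_of_mem_erase h)]
    ring

theorem X_dvd_eulerDeriv (F : ℂ⟦X⟧) : (PowerSeries.X : ℂ⟦X⟧) ∣ eulerDeriv F := Dvd.intro _ rfl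

theorem BoundedCoeffs.eulerDeriv {α : Type*} [MeasurableSpace α] {F : α → ℂ⟦X⟧}
    (hF : BoundedCoeffs F) : BoundedCoeffs fun x => eulerDeriv (F x) := by
  intro n
  obtain ⟨hm, C, hC⟩ := hF n
  simp only [coeff_eulerDeriv]
  refine ⟨hm.const_mul _, n * C, fun x => ?_⟩
  rw [norm_mul, Complex.norm_natCast]
  exact mul_le_mul_of_nonneg_left (hC x) n.cast_nonneg

end CoefficientIntegrals

/-! ### The cycle expansion summed over the orders of the points -/

section CycleExpansion

open Equiv

theorem take_ofFn_add {X : Type*} {r s : ℕ} (x : Fin (r + s) → X) :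
    (List.ofFn x).take r = List.ofFn fun i => x (Fin.castAdd s i) := by
  rw [List.ofFn_add, List.take_left' (by simp)]
  rfl

theorem drop_ofFn_add {X : Type*} {r s : ℕ} (x : Fin (r + s) → X) :
    (List.ofFn x).drop r = List.ofFn fun i => x (Fin.natAdd r i) := by
  rw [List.ofFn_add, List.drop_left' (by simp)]

variable {X : Type*} (K : X → X → Matrix (Fin 2) (Fin 2) ℂ)

/-- The contribution to the Pfaffian of the cycles through `z` and the points of `L`. -/
def cyclePfaffian (z : X) (L : List X) : ℂ :=
  1 / 2 * (-1) ^ L.length *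
    ∑ σ : Perm (Fin L.length), (pathProd K z z (List.ofFn (L.get ∘ σ))).trace

theorem cyclePfaffian_ofFn {n : ℕ} (z : X) (x : Fin n → X) :
    cyclePfaffian K z (List.ofFn x) =
      1 / 2 * (-1) ^ n * ∑ σ : Perm (Fin n), (pathProd K z z (List.ofFn (x ∘ σ))).trace := by
  have h : ∀ (L : List X) (n : ℕ) (hn : n = L.length), cyclePfaffian K z L =
      1 / 2 * (-1) ^ n * ∑ σ : Perm (Fin n),
        (pathProd K z z (List.ofFn ((fun i : Fin n => L.get (i.cast hn)) ∘ σ))).trace := by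
    rintro L n rfl
    rfl
  rw [h _ n (List.length_ofFn).symm]
  congr! with σ
  simp

theorem cyclePfaffian_comp_perm {n : ℕ} (z : X) (x : Fin n → X) (τ : Perm (Fin n)) :
    cyclePfaffian K z (List.ofFn (x ∘ τ)) = cyclePfaffian K z (List.ofFn x) := by
  rw [cyclePfaffian_ofFn, cyclePfaffian_ofFn, ← Equiv.sum_comp (Equiv.mulLeft τ)
    fun σ => (pathProd K z z (List.ofFn (x ∘ σ))).trace]
  rfl

/-- A reordering of the `r` points on the cycle extends to a permutation of all the points and is
absorbed by the sum over `τ`. The sum over such reorderings then only contributes the factor `r!`.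
-/
theorem sum_cyclePfaffian_take (z : X) {r s : ℕ} (x : Fin (r + s) → X) :
    ∑ τ : Perm (Fin (r + s)), cyclePfaffian K z ((List.ofFn (x ∘ τ)).take r) *
        listPfaffian K ((List.ofFn (x ∘ τ)).drop r) =
      (r.factorial : ℂ) * (-1) ^ r * ∑ τ : Perm (Fin (r + s)),
        1 / 2 * (pathProd K z z ((List.ofFn (x ∘ τ)).take r)).trace *
          listPfaffian K ((List.ofFn (x ∘ τ)).drop r) := by
  let ext : Perm (Fin r) → Perm (Fin (r + s)) := fun σ =>
    finSumFinEquiv.permCongr (Equiv.sumCongr σ (Equiv.refl _))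
  have hl : ∀ σ i, ext σ (Fin.castAdd s i) = Fin.castAdd s (σ i) := fun σ i => by
    simp [ext, permCongr_apply]
  have hr : ∀ σ i, ext σ (Fin.natAdd r i) = Fin.natAdd r i := fun σ i => by
    simp [ext, permCongr_apply]
  simp only [take_ofFn_add, drop_ofFn_add, cyclePfaffian_ofFn]
  calc _ = ∑ σ : Perm (Fin r), ∑ τ : Perm (Fin (r + s)), (-1) ^ r * (1 / 2 *
        (pathProd K z z (List.ofFn fun i => (x ∘ (τ * ext σ)) (Fin.castAdd s i))).trace *
        listPfaffian K (List.ofFn fun i => (x ∘ (τ * ext σ)) (Fin.natAdd r i))) := by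
        rw [Finset.sum_comm]
        refine Finset.sum_congr rfl fun τ _ => ?_
        rw [Finset.mul_sum, Finset.sum_mul]
        refine Finset.sum_congr rfl fun σ _ => ?_
        simp only [Function.comp_def, Perm.mul_apply, hl, hr]
        ring
    _ = ∑ σ : Perm (Fin r), ∑ τ : Perm (Fin (r + s)), (-1) ^ r * (1 / 2 *
        (pathProd K z z (List.ofFn fun i => (x ∘ τ) (Fin.castAdd s i))).trace *
        listPfaffian K (List.ofFn fun i => (x ∘ τ) (Fin.natAdd r i))) := by
        refine Finset.sum_congr rfl fun σ _ => ?_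
        exact Equiv.sum_comp (Equiv.mulRight (ext σ)) fun τ : Perm (Fin (r + s)) => (-1) ^ r *
          (1 / 2 * (pathProd K z z (List.ofFn fun i => (x ∘ τ) (Fin.castAdd s i))).trace *
          listPfaffian K (List.ofFn fun i => (x ∘ τ) (Fin.natAdd r i)))
    _ = _ := by
        rw [Finset.sum_const, Finset.card_univ, Fintype.card_perm, Fintype.card_fin,
          nsmul_eq_mul, ← Finset.mul_sum]
        ring

variable {K}

/-- This symmetrised form is the one to integrate: its cycle terms inherit integrability from the
Pfaffians, which is not known for each single trace. -/
theorem kernelPfaffian_cons_eq_sum_cyclePfaffian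
    (hA : ∀ u v, kernelForm K u v = -kernelForm K v u) {n : ℕ} (z : X) (x : Fin n → X) :
    kernelPfaffian K (Fin.cons z x : Fin (n + 1) → X) =
      ∑ r ∈ Finset.range (n + 1), 1 / ((r.factorial : ℂ) * ((n - r).factorial : ℂ)) *
        ∑ τ : Perm (Fin n), cyclePfaffian K z ((List.ofFn (x ∘ τ)).take r) *
          listPfaffian K ((List.ofFn (x ∘ τ)).drop r) := by
  rw [kernelPfaffian_cons_eq_sum hA]
  refine Finset.sum_congr rfl fun r hr => ?_
  obtain ⟨s, rfl⟩ := Nat.exists_eq_add_of_le (Nat.lt_succ_iff.1 (Finset.mem_range.1 hr))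
  rw [sum_cyclePfaffian_take, Nat.add_sub_cancel_left]
  have h1 : (r.factorial : ℂ) ≠ 0 := by exact_mod_cast r.factorial_ne_zero
  have h2 : (s.factorial : ℂ) ≠ 0 := by exact_mod_cast s.factorial_ne_zero
  field_simp

end CycleExpansion

/-! ### Integrability of the cycle terms -/

section CycleIntegrals

open Equiv PowerSeries

variable {X : Type*} [MeasurableSpace X] {K : X → X → Matrix (Fin 2) (Fin 2) ℂ} {ν : Measure X}
  [SigmaFinite ν]

/-- Appending points to the points of a cycle, as a measurable equivalence. -/
def consAppendEquiv (X : Type*) [MeasurableSpace X] (r s : ℕ) :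
    (X × (Fin r → X)) × (Fin s → X) ≃ᵐ X × (Fin (r + s) → X) :=
  MeasurableEquiv.prodAssoc.trans ((MeasurableEquiv.refl X).prodCongr (appendEquiv r s))

theorem consAppendEquiv_apply {r s : ℕ} (p : (X × (Fin r → X)) × (Fin s → X)) :
    consAppendEquiv X r s p = (p.1.1, Fin.append p.1.2 p.2) := by
  obtain ⟨⟨z, x⟩, y⟩ := p
  exact Prod.ext rfl (appendEquiv_apply (x, y))

theorem measurePreserving_consAppendEquiv (r s : ℕ) :
    MeasurePreserving (consAppendEquiv X r s)
      ((ν.prod (Measure.pi fun _ => ν)).prod (Measure.pi fun _ => ν))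
      (ν.prod (Measure.pi fun _ => ν)) := by
  refine (measurePreserving_prodAssoc ν _ _).trans ?_
  exact (MeasurePreserving.id ν).prod (measurePreserving_appendEquiv ν r s)

/-- Reindexing the points after the first one, as a measurable equivalence. -/
def consReindexEquiv (X : Type*) [MeasurableSpace X] {n : ℕ} (τ : Perm (Fin n)) :
    X × (Fin n → X) ≃ᵐ X × (Fin n → X) :=
  (MeasurableEquiv.refl X).prodCongr (reindexEquiv τ)

theorem consReindexEquiv_apply {n : ℕ} (τ : Perm (Fin n)) (p : X × (Fin n → X)) :
    consReindexEquiv X τ p = (p.1, p.2 ∘ τ) :=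
  Prod.ext rfl (reindexEquiv_apply τ p.2)

theorem measurePreserving_consReindexEquiv {n : ℕ} (τ : Perm (Fin n)) :
    MeasurePreserving (consReindexEquiv X τ) (ν.prod (Measure.pi fun _ => ν))
      (ν.prod (Measure.pi fun _ => ν)) :=
  (MeasurePreserving.id ν).prod (measurePreserving_reindexEquiv ν τ)

theorem integrable_cyclePfaffian_mul {r s : ℕ}
    (hT : Integrable (fun p : X × (Fin r → X) => cyclePfaffian K p.1 (List.ofFn p.2))
      (ν.prod (Measure.pi fun _ => ν)))
    (hP : Integrable (kernelPfaffian K : (Fin s → X) → ℂ) (Measure.pi fun _ => ν)) :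
    Integrable (fun p : X × (Fin (r + s) → X) => cyclePfaffian K p.1 ((List.ofFn p.2).take r) *
      listPfaffian K ((List.ofFn p.2).drop r)) (ν.prod (Measure.pi fun _ => ν)) := by
  rw [← (measurePreserving_consAppendEquiv r s).integrable_comp_emb
    (consAppendEquiv X r s).measurableEmbedding]
  refine (hT.mul_prod hP).congr (ae_of_all _ fun p => ?_)
  simp only [Function.comp_apply, consAppendEquiv_apply, List.ofFn_fin_append]
  rw [List.take_left' (by simp), List.drop_left' (by simp), listPfaffian_ofFn]

theorem integrable_cyclePfaffian_mul_perm {n r : ℕ} (hr : r ≤ n)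
    (hT : Integrable (fun p : X × (Fin r → X) => cyclePfaffian K p.1 (List.ofFn p.2))
      (ν.prod (Measure.pi fun _ => ν)))
    (hP : ∀ s, Integrable (kernelPfaffian K : (Fin s → X) → ℂ) (Measure.pi fun _ => ν))
    (τ : Perm (Fin n)) :
    Integrable (fun p : X × (Fin n → X) => cyclePfaffian K p.1 ((List.ofFn (p.2 ∘ τ)).take r) *
      listPfaffian K ((List.ofFn (p.2 ∘ τ)).drop r)) (ν.prod (Measure.pi fun _ => ν)) := by
  obtain ⟨s, rfl⟩ := Nat.exists_eq_add_of_le hr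
  have := ((measurePreserving_consReindexEquiv (ν := ν) τ).integrable_comp_emb
    (consReindexEquiv X τ).measurableEmbedding).2 (integrable_cyclePfaffian_mul hT (hP s))
  refine this.congr (ae_of_all _ fun p => ?_)
  simp only [Function.comp_apply, consReindexEquiv_apply]

theorem integrable_kernelPfaffian_cons {n : ℕ}
    (hP : Integrable (kernelPfaffian K : (Fin (n + 1) → X) → ℂ) (Measure.pi fun _ => ν)) :
    Integrable (fun p : X × (Fin n → X) => kernelPfaffian K (Fin.cons p.1 p.2 : Fin (n + 1) → X))
      (ν.prod (Measure.pi fun _ => ν)) := by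
  refine (((measurePreserving_consEquiv ν n).integrable_comp_emb
    (consEquiv n).measurableEmbedding).2 hP).congr (ae_of_all _ fun p => ?_)
  simp only [Function.comp_apply, consEquiv_apply]

/-- In the expansion of the Pfaffian of `n + 1` points, the term `r = n` is the cycle term itself.
All other terms are products, in separate variables, of shorter cycle terms and Pfaffians, so strong
induction applies. -/
theorem integrable_cyclePfaffian (hA : ∀ u v, kernelForm K u v = -kernelForm K v u)
    (hP : ∀ s, Integrable (kernelPfaffian K : (Fin s → X) → ℂ) (Measure.pi fun _ => ν)) (n : ℕ) :
    Integrable (fun p : X × (Fin n → X) => cyclePfaffian K p.1 (List.ofFn p.2))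
      (ν.prod (Measure.pi fun _ => ν)) := by
  induction n using Nat.strong_induction_on with
  | _ n ih =>
    have h : ∀ p : X × (Fin n → X), cyclePfaffian K p.1 (List.ofFn p.2) =
        kernelPfaffian K (Fin.cons p.1 p.2 : Fin (n + 1) → X) -
          ∑ r ∈ Finset.range n, 1 / ((r.factorial : ℂ) * ((n - r).factorial : ℂ)) *
            ∑ τ : Perm (Fin n), cyclePfaffian K p.1 ((List.ofFn (p.2 ∘ τ)).take r) *
              listPfaffian K ((List.ofFn (p.2 ∘ τ)).drop r) := by
      intro p
      rw [kernelPfaffian_cons_eq_sum_cyclePfaffian hA, Finset.sum_range_succ, add_sub_cancel_left]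
      have h1 : ∀ τ : Perm (Fin n), cyclePfaffian K p.1 ((List.ofFn (p.2 ∘ τ)).take n) *
          listPfaffian K ((List.ofFn (p.2 ∘ τ)).drop n) = cyclePfaffian K p.1 (List.ofFn p.2) := by
        intro τ
        have h0 : listPfaffian K [] = 1 := pfaffian_zero _
        rw [List.take_of_length_le (by simp), List.drop_of_length_le (by simp), h0, mul_one,
          cyclePfaffian_comp_perm]
      simp only [h1, Finset.sum_const, Finset.card_univ, Fintype.card_perm, Fintype.card_fin,
        nsmul_eq_mul, Nat.sub_self, Nat.factorial_zero, Nat.cast_one, mul_one]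
      have : (n.factorial : ℂ) ≠ 0 := by exact_mod_cast n.factorial_ne_zero
      field_simp
    refine Integrable.congr ?_ (ae_of_all _ fun p => (h p).symm)
    refine (integrable_kernelPfaffian_cons (hP _)).sub (integrable_finsetSum _ fun r hr => ?_)
    refine (integrable_finsetSum _ fun τ _ => ?_).const_mul _
    have hr := Finset.mem_range.1 hr
    exact integrable_cyclePfaffian_mul_perm hr.le (ih r hr) hP τ

variable {h : X → ℂ⟦X⟧}

/-- The integrals of `∏ h(x_i)` against the Pfaffian. -/
def pfaffianSeries (K : X → X → Matrix (Fin 2) (Fin 2) ℂ) (ν : Measure X) (h : X → ℂ⟦X⟧) (k : ℕ) :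
    ℂ⟦X⟧ :=
  coeffIntegral (Measure.pi fun _ : Fin k => ν) (fun x => ∏ i, h (x i)) (kernelPfaffian K)

/-- The integrals of `h'(z) ∏ h(x_i)` against the cycle part of the Pfaffian. -/
def cycleSeries (K : X → X → Matrix (Fin 2) (Fin 2) ℂ) (ν : Measure X) (h : X → ℂ⟦X⟧) (r : ℕ) :
    ℂ⟦X⟧ :=
  coeffIntegral (ν.prod (Measure.pi fun _ : Fin r => ν))
    (fun p => eulerDeriv (h p.1) * ∏ i, h (p.2 i)) fun p => cyclePfaffian K p.1 (List.ofFn p.2)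

theorem BoundedCoeffs.pi_prod (hh : BoundedCoeffs h) (n : ℕ) :
    BoundedCoeffs fun x : Fin n → X => ∏ i, h (x i) :=
  BoundedCoeffs.prod _ fun i => hh.comp (measurable_pi_apply i)

theorem BoundedCoeffs.eulerDeriv_mul_prod (hh : BoundedCoeffs h) (n : ℕ) :
    BoundedCoeffs fun p : X × (Fin n → X) => _root_.eulerDeriv (h p.1) * ∏ i, h (p.2 i) :=
  (hh.eulerDeriv.comp measurable_fst).mul ((hh.pi_prod n).comp measurable_snd)

end CycleIntegrals

/-! ### The recursion between moment and cycle series -/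

section CumulantRecursion

open Equiv PowerSeries

variable {X : Type*} [MeasurableSpace X] {K : X → X → Matrix (Fin 2) (Fin 2) ℂ} {ν : Measure X}
  [SigmaFinite ν] {h : X → ℂ⟦X⟧}

/-- After undoing `τ`, the points on the cycle and the points off it are separate variables, and
Fubini factors every coefficient. -/
theorem coeffIntegral_cyclePfaffian_mul (hh : BoundedCoeffs h) {r s : ℕ}
    (hT : Integrable (fun p : X × (Fin r → X) => cyclePfaffian K p.1 (List.ofFn p.2))
      (ν.prod (Measure.pi fun _ => ν)))
    (hP : Integrable (kernelPfaffian K : (Fin s → X) → ℂ) (Measure.pi fun _ => ν))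
    (τ : Perm (Fin (r + s))) :
    coeffIntegral (ν.prod (Measure.pi fun _ : Fin (r + s) => ν))
      (fun p => eulerDeriv (h p.1) * ∏ i, h (p.2 i))
      (fun p => cyclePfaffian K p.1 ((List.ofFn (p.2 ∘ τ)).take r) *
        listPfaffian K ((List.ofFn (p.2 ∘ τ)).drop r)) =
      cycleSeries K ν h r * pfaffianSeries K ν h s := by
  rw [cycleSeries, pfaffianSeries,
    ← coeffIntegral_prod_mul (hh.eulerDeriv_mul_prod r) (hh.pi_prod s) hT hP]
  have h1 := coeffIntegral_comp (measurePreserving_consReindexEquiv (ν := ν) τ)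
    (fun p => eulerDeriv (h p.1) * ∏ i, h (p.2 i))
    (fun p => cyclePfaffian K p.1 ((List.ofFn p.2).take r) *
        listPfaffian K ((List.ofFn p.2).drop r))
  have h2 := coeffIntegral_comp (measurePreserving_consAppendEquiv (ν := ν) r s)
    (fun p => eulerDeriv (h p.1) * ∏ i, h (p.2 i))
    (fun p => cyclePfaffian K p.1 ((List.ofFn p.2).take r) *
        listPfaffian K ((List.ofFn p.2).drop r))
  rw [← h2] at h1
  simp only [consReindexEquiv_apply, consAppendEquiv_apply, List.ofFn_fin_append] at h1
  convert h1 using 2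
  · ext1 p
    congr 1
    exact (Equiv.prod_comp τ fun i => h (p.2 i)).symm
  · ext1 p
    rw [Fin.prod_univ_add]
    simp [mul_assoc]
  · ext1 p
    rw [List.take_left' (by simp), List.drop_left' (by simp), listPfaffian_ofFn]

theorem coeffIntegral_kernelPfaffian_cons (hA : ∀ u v, kernelForm K u v = -kernelForm K v u)
    (hP : ∀ s, Integrable (kernelPfaffian K : (Fin s → X) → ℂ) (Measure.pi fun _ => ν))
    (hh : BoundedCoeffs h) (n : ℕ) :
    coeffIntegral (ν.prod (Measure.pi fun _ : Fin n => ν))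
      (fun p => eulerDeriv (h p.1) * ∏ i, h (p.2 i))
      (fun p => kernelPfaffian K (Fin.cons p.1 p.2 : Fin (n + 1) → X)) =
      ∑ r ∈ Finset.range (n + 1), ((n.factorial : ℂ) / (r.factorial * (n - r).factorial)) •
        (cycleSeries K ν h r * pfaffianSeries K ν h (n - r)) := by
  have hT := integrable_cyclePfaffian hA hP
  simp only [kernelPfaffian_cons_eq_sum_cyclePfaffian hA]
  rw [coeffIntegral_sum (hh.eulerDeriv_mul_prod n)]
  · refine Finset.sum_congr rfl fun r hr => ?_
    have hr := Nat.lt_succ_iff.1 (Finset.mem_range.1 hr)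
    have h1 := coeffIntegral_sum (μ := ν.prod (Measure.pi fun _ : Fin n => ν))
      (hh.eulerDeriv_mul_prod n) (Finset.univ : Finset (Perm (Fin n))) (fun _ => 1)
      fun τ _ => integrable_cyclePfaffian_mul_perm hr (hT r) hP τ
    simp only [one_mul, one_smul] at h1
    rw [h1]
    obtain ⟨s, rfl⟩ := Nat.exists_eq_add_of_le hr
    simp only [coeffIntegral_cyclePfaffian_mul hh (hT r) (hP s), Nat.add_sub_cancel_left,
      Finset.sum_const, Finset.card_univ, Fintype.card_perm, Fintype.card_fin]
    rw [← Nat.cast_smul_eq_nsmul ℂ, smul_smul]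
    congr 1
    ring
  · intro r hr
    have hr := Nat.lt_succ_iff.1 (Finset.mem_range.1 hr)
    exact integrable_finsetSum _ fun τ _ => integrable_cyclePfaffian_mul_perm hr (hT r) hP τ

/-- The Leibniz rule gives one term for each differentiated factor. By the symmetry of `g` that
factor can be moved to position `0`, so the `n + 1` terms agree. -/
theorem eulerDeriv_coeffIntegral_prod (hh : BoundedCoeffs h) {n : ℕ}
    {g : (Fin (n + 1) → X) → ℂ} (hg : Integrable g (Measure.pi fun _ => ν))
    (hsymm : ∀ (τ : Perm (Fin (n + 1))) x, g (x ∘ τ) = g x) :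
    eulerDeriv (coeffIntegral (Measure.pi fun _ => ν) (fun x => ∏ i, h (x i)) g) =
      (n + 1 : ℂ) • coeffIntegral (ν.prod (Measure.pi fun _ : Fin n => ν))
        (fun p => eulerDeriv (h p.1) * ∏ i, h (p.2 i))
        (fun p => g (Fin.cons p.1 p.2)) := by
  have hF : ∀ i : Fin (n + 1), BoundedCoeffs fun x : Fin (n + 1) → X =>
      eulerDeriv (h (x i)) * ∏ j ∈ Finset.univ.erase i, h (x j) := fun i =>
    (hh.eulerDeriv.comp (measurable_pi_apply i)).mul
      (BoundedCoeffs.prod _ fun j => hh.comp (measurable_pi_apply j))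
  have hi : ∀ i : Fin (n + 1), coeffIntegral (Measure.pi fun _ => ν)
      (fun x : Fin (n + 1) → X => eulerDeriv (h (x i)) * ∏ j ∈ Finset.univ.erase i, h (x j)) g =
      coeffIntegral (ν.prod (Measure.pi fun _ : Fin n => ν))
        (fun p => eulerDeriv (h p.1) * ∏ i, h (p.2 i)) (fun p => g (Fin.cons p.1 p.2)) := by
    intro i
    rw [← coeffIntegral_comp (measurePreserving_reindexEquiv ν (swap 0 i)),
      ← coeffIntegral_comp (measurePreserving_consEquiv ν n)]
    simp only [reindexEquiv_apply, consEquiv_apply, hsymm, Function.comp_apply, swap_apply_right]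
    congr 1
    ext1 p
    rw [Finset.prod_equiv (swap 0 i) (t := Finset.univ.erase 0)
      (g := fun j => h ((Fin.cons p.1 p.2 : Fin (n + 1) → X) j))]
    · have h1 : Finset.univ.erase (0 : Fin (n + 1)) = Finset.univ.map (Fin.succEmb n) := by
        ext j
        refine Fin.cases ?_ (fun j => ?_) j <;> simp
      rw [Fin.cons_zero, h1, Finset.prod_map]
      simp
    · intro j
      simp only [Finset.mem_erase, Finset.mem_univ, and_true, ne_eq]
      rw [swap_apply_eq_iff, swap_apply_left]
    · simp
  have h1 : eulerDeriv (coeffIntegral (Measure.pi fun _ => ν) (fun x => ∏ i, h (x i)) g) =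
      ∑ i : Fin (n + 1), coeffIntegral (Measure.pi fun _ => ν)
        (fun x : Fin (n + 1) → X => eulerDeriv (h (x i)) * ∏ j ∈ Finset.univ.erase i, h (x j))
        g := by
    ext m
    simp only [coeff_eulerDeriv, coeff_coeffIntegral, map_sum]
    rw [← integral_const_mul, ← integral_finsetSum _ fun i _ => (hF i).integrable_mul hg m]
    congr 1
    ext x
    rw [← mul_assoc, ← coeff_eulerDeriv, eulerDeriv_prod, map_sum, Finset.sum_mul]
  rw [h1, Finset.sum_congr rfl fun i _ => hi i, Finset.sum_const, Finset.card_univ,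
    Fintype.card_fin, ← Nat.cast_smul_eq_nsmul ℂ]
  push_cast
  rfl

theorem eulerDeriv_smul (c : ℂ) (F : ℂ⟦X⟧) : eulerDeriv (c • F) = c • eulerDeriv F := by
  ext n
  simp only [coeff_eulerDeriv, coeff_smul, smul_eq_mul]
  ring

/-- The factorials cancel exactly: `(n + 1) / (n + 1)!` times `n! / (r! (n - r)!)` is `1 / (r! (n -
r)!)`. -/
theorem eulerDeriv_pfaffianSeries (hA : ∀ u v, kernelForm K u v = -kernelForm K v u)
    (hP : ∀ s, Integrable (kernelPfaffian K : (Fin s → X) → ℂ) (Measure.pi fun _ => ν))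
    (hh : BoundedCoeffs h) (n : ℕ) :
    eulerDeriv ((1 / ((n + 1).factorial : ℂ)) • pfaffianSeries K ν h (n + 1)) =
      ∑ q ∈ Finset.HasAntidiagonal.antidiagonal n,
        ((1 / (q.1.factorial : ℂ)) • cycleSeries K ν h q.1) *
          ((1 / (q.2.factorial : ℂ)) • pfaffianSeries K ν h q.2) := by
  rw [eulerDeriv_smul, pfaffianSeries, eulerDeriv_coeffIntegral_prod hh (hP _)
    fun τ x => kernelPfaffian_comp_perm K x τ, coeffIntegral_kernelPfaffian_cons hA hP hh,
    Finset.Nat.sum_antidiagonal_eq_sum_range_succ (fun r s =>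
      ((1 / (r.factorial : ℂ)) • cycleSeries K ν h r) *
        ((1 / (s.factorial : ℂ)) • pfaffianSeries K ν h s)), Finset.smul_sum, Finset.smul_sum]
  refine Finset.sum_congr rfl fun r _ => ?_
  rw [smul_mul_smul_comm, smul_smul, smul_smul]
  congr 1
  rw [Nat.factorial_succ]
  have h1 : (n.factorial : ℂ) ≠ 0 := by exact_mod_cast n.factorial_ne_zero
  have h2 : (n + 1 : ℂ) ≠ 0 := by exact_mod_cast n.succ_ne_zero
  push_cast
  field_simp

/-- The omitted terms have order greater than `n`, so every sufficiently long truncation has the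
same `n`-th coefficient. This lets the infinite sums over `k` be defined coefficientwise. -/
theorem coeff_mk_sum_range {A : ℕ → ℂ⟦X⟧} {d : ℕ}
    (hA : ∀ k, (PowerSeries.X : ℂ⟦X⟧) ^ (k + d) ∣ A k) {n N M : ℕ} (hM : n < M + d)
    (hN : M ≤ N) :
    ∑ k ∈ Finset.range M, coeff n (A k) = coeff n (∑ k ∈ Finset.range N, A k) := by
  rw [map_sum]
  refine Finset.sum_subset (Finset.range_mono hN) fun k _ hk => ?_
  exact PowerSeries.X_pow_dvd_iff.1 (hA k) n (by rw [Finset.mem_range] at hk; omega)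

/-- If `∑ A_k` and `∑ C_r` satisfy the recursion `k A_k = ∑ C_r A_{k - 1 - r}`, then `∑ C_r` is the
logarithmic derivative of `∑ A_k`. -/
theorem eulerDeriv_mk_sum {A C : ℕ → ℂ⟦X⟧} (hA : ∀ k, (PowerSeries.X : ℂ⟦X⟧) ^ k ∣ A k)
    (hC : ∀ k, (PowerSeries.X : ℂ⟦X⟧) ^ (k + 1) ∣ C k) (hA0 : eulerDeriv (A 0) = 0)
    (hrec : ∀ n, eulerDeriv (A (n + 1)) =
      ∑ q ∈ Finset.HasAntidiagonal.antidiagonal n, C q.1 * A q.2) :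
    eulerDeriv (PowerSeries.mk fun n => ∑ k ∈ Finset.range (n + 1), coeff n (A k)) =
      (PowerSeries.mk fun n => ∑ r ∈ Finset.range n, coeff n (C r)) *
        PowerSeries.mk fun n => ∑ k ∈ Finset.range (n + 1), coeff n (A k) := by
  ext n
  have h1 : coeff n ((PowerSeries.mk fun n => ∑ r ∈ Finset.range n, coeff n (C r)) *
        PowerSeries.mk fun n => ∑ k ∈ Finset.range (n + 1), coeff n (A k)) =
      coeff n ((∑ r ∈ Finset.range n, C r) * ∑ k ∈ Finset.range (n + 1), A k) := by
    rw [coeff_mul, coeff_mul]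
    refine Finset.sum_congr rfl fun q hq => ?_
    have hq := Finset.HasAntidiagonal.mem_antidiagonal.1 hq
    rw [coeff_mk, coeff_mk, coeff_mk_sum_range hC (by omega) (show q.1 ≤ n by omega),
      coeff_mk_sum_range (d := 0) hA (by omega) (show q.2 + 1 ≤ n + 1 by omega)]
  rw [h1, coeff_eulerDeriv, coeff_mk, Finset.mul_sum, Finset.sum_range_succ',
    ← coeff_eulerDeriv, hA0, map_zero, add_zero, Finset.sum_mul, map_sum]
  have h2 : ∀ m, (n : ℂ) * coeff n (A (m + 1)) =
      ∑ r ∈ Finset.range (m + 1), coeff n (C r * A (m - r)) := by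
    intro m
    rw [← coeff_eulerDeriv, hrec, Finset.Nat.sum_antidiagonal_eq_sum_range_succ
      (fun r s => C r * A s), map_sum]
  rw [Finset.sum_congr rfl fun m _ => h2 m,
    Finset.sum_range_diag_flip n fun r s => coeff n (C r * A s)]
  refine Finset.sum_congr rfl fun r hr => ?_
  have hr := Finset.mem_range.1 hr
  rw [Finset.mul_sum, map_sum]
  refine Finset.sum_subset (Finset.range_mono (by omega)) fun s _ hs => ?_
  -- The pairs absent from the triangular sum satisfy `n ≤ r + s`, and by this order bound they
  -- contribute nothing.
  have h3 : (PowerSeries.X : ℂ⟦X⟧) ^ (r + 1 + s) ∣ C r * A s := by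
    rw [pow_add]
    exact mul_dvd_mul (hC r) (hA s)
  exact PowerSeries.X_pow_dvd_iff.1 h3 n (by rw [Finset.mem_range] at hs; omega)

/-- The generating series of the moments in terms of the Pfaffian correlation functions. -/
def momentSeries (K : X → X → Matrix (Fin 2) (Fin 2) ℂ) (ν : Measure X) (h : X → ℂ⟦X⟧) : ℂ⟦X⟧ :=
  PowerSeries.mk fun n => ∑ k ∈ Finset.range (n + 1),
    coeff n ((1 / (k.factorial : ℂ)) • pfaffianSeries K ν h k)

/-- The logarithmic derivative of the generating series of the moments. -/
def cumulantSeries (K : X → X → Matrix (Fin 2) (Fin 2) ℂ) (ν : Measure X) (h : X → ℂ⟦X⟧) :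
    ℂ⟦X⟧ :=
  PowerSeries.mk fun n => ∑ r ∈ Finset.range n,
    coeff n ((1 / (r.factorial : ℂ)) • cycleSeries K ν h r)

theorem X_pow_dvd_prod {X : Type*} {h : X → ℂ⟦X⟧} (h0 : ∀ x, (PowerSeries.X : ℂ⟦X⟧) ∣ h x) {n : ℕ} (x : Fin n → X) :
    (PowerSeries.X : ℂ⟦X⟧) ^ n ∣ ∏ i, h (x i) := by
  have := Finset.prod_dvd_prod_of_dvd (s := (Finset.univ : Finset (Fin n)))
    (fun _ => (PowerSeries.X : ℂ⟦X⟧)) (fun i => h (x i)) fun i _ => h0 _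
  simpa using this

theorem eulerDeriv_momentSeries (hA : ∀ u v, kernelForm K u v = -kernelForm K v u)
    (hP : ∀ s, Integrable (kernelPfaffian K : (Fin s → X) → ℂ) (Measure.pi fun _ => ν))
    (hh : BoundedCoeffs h) (h0 : ∀ x, (PowerSeries.X : ℂ⟦X⟧) ∣ h x) :
    eulerDeriv (momentSeries K ν h) = cumulantSeries K ν h * momentSeries K ν h := by
  refine eulerDeriv_mk_sum (fun k => ?_) (fun k => ?_) ?_ fun n =>
    eulerDeriv_pfaffianSeries hA hP hh n
  · exact dvd_smul_of_dvd _ (X_pow_dvd_coeffIntegral fun x => X_pow_dvd_prod h0 x)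
  · refine dvd_smul_of_dvd _ (X_pow_dvd_coeffIntegral fun p => ?_)
    rw [pow_succ']
    exact mul_dvd_mul (X_dvd_eulerDeriv _) (X_pow_dvd_prod h0 p.2)
  · ext n
    rw [coeff_eulerDeriv, coeff_smul, pfaffianSeries, coeff_coeffIntegral]
    cases n with
    | zero => simp
    | succ n => simp [PowerSeries.coeff_one]

end CumulantRecursion

/-! ### Extraction of the coefficients as a sum over compositions -/

section CompositionSum

open PowerSeries

variable {X : Type*}

/-- The start `y` is kept separate from the end `z` so that the induction can shorten the path; a
cycle is the case `y = z`. -/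
theorem prod_ofFn_snoc_eq_pathProd (K : X → X → Matrix (Fin 2) (Fin 2) ℂ) (z : X) {r : ℕ} :
    ∀ (y : X) (u : Fin r → X), (List.ofFn fun i : Fin (r + 1) =>
      K ((Fin.cons y u : Fin (r + 1) → X) i) ((Fin.snoc u z : Fin (r + 1) → X) i)).prod =
        pathProd K z y (List.ofFn u) := by
  induction r with
  | zero =>
    intro y u
    simp [pathProd, Fin.snoc]
  | succ r ih =>
    intro y u
    obtain ⟨a, v, rfl⟩ : ∃ a v, u = (Fin.cons a v : Fin (r + 1) → X) :=
      ⟨_, _, (Fin.cons_self_tail u).symm⟩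
    rw [List.ofFn_succ, List.prod_cons, ← Fin.cons_snoc_eq_snoc_cons]
    simp only [Fin.cons_zero, Fin.cons_succ, ih]
    rw [List.ofFn_succ, pathProd]
    simp

theorem cycleTrace_cons (K : X → X → Matrix (Fin 2) (Fin 2) ℂ) (z : X) {r : ℕ} (u : Fin r → X) :
    cycleTrace K (Fin.cons z u : Fin (r + 1) → X) = (pathProd K z z (List.ofFn u)).trace := by
  rw [cycleTrace, ← prod_ofFn_snoc_eq_pathProd, Fin.snoc_eq_cons_rotate]

theorem finRotate_castSucc {r : ℕ} (i : Fin r) : finRotate (r + 1) i.castSucc = i.succ := by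
  ext
  rw [coe_finRotate_of_ne_last i.castSucc_ne_last]
  simp

theorem cycleTrace_comp_finRotate (K : X → X → Matrix (Fin 2) (Fin 2) ℂ) {r : ℕ}
    (x : Fin (r + 1) → X) : cycleTrace K (x ∘ finRotate (r + 1)) = cycleTrace K x := by
  rw [cycleTrace, cycleTrace, List.ofFn_succ', List.concat_eq_append, List.prod_append,
    Matrix.trace_mul_comm, List.ofFn_succ, List.prod_cons]
  simp

/-- The power series `exp(f(x) t) - 1`. -/
def expSubOne (f : X → ℝ) (x : X) : ℂ⟦X⟧ := rescale (f x : ℂ) (PowerSeries.exp ℂ) - 1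

/-- The coefficients of `exp t - 1`. -/
def expSubOneCoeff (m : ℕ) : ℂ := if m = 0 then 0 else 1 / (m.factorial : ℂ)

theorem coeff_expSubOne (f : X → ℝ) (x : X) (m : ℕ) :
    coeff m (expSubOne f x) = expSubOneCoeff m * (f x : ℂ) ^ m := by
  rw [expSubOne, map_sub, coeff_rescale, coeff_exp, coeff_one, expSubOneCoeff]
  rcases eq_or_ne m 0 with rfl | hm
  · simp
  · simp [hm, mul_comm]

/-- The positive `k`-tuples with sum `n`. -/
def positiveTuples (k n : ℕ) : Finset (Fin k → ℕ) :=
  (Finset.univ.piAntidiag n).filter fun l => ∀ i, 0 < l i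

theorem mem_positiveTuples {k n : ℕ} {l : Fin k → ℕ} :
    l ∈ positiveTuples k n ↔ ∑ i, l i = n ∧ ∀ i, 0 < l i := by
  simp [positiveTuples]

theorem sum_composition {n : ℕ} (G : ∀ k : ℕ, (Fin k → ℕ) → ℂ) (hn : 0 < n) :
    ∑ c : Composition n, G c.length c.blocksFun =
      ∑ r ∈ Finset.range n, ∑ l ∈ positiveTuples (r + 1) n, G (r + 1) l := by
  have h0 : ∑ l ∈ positiveTuples 0 n, G 0 l = 0 := by
    rw [Finset.sum_eq_zero]
    intro l hl
    have := (mem_positiveTuples.1 hl).1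
    simp at this
    omega
  rw [← add_zero (∑ r ∈ Finset.range n, _), ← h0,
    ← Finset.sum_range_succ' (fun k => ∑ l ∈ positiveTuples k n, G k l), Finset.sum_sigma']
  refine Finset.sum_nbij (fun c => ⟨c.length, c.blocksFun⟩) ?_ ?_ ?_ fun _ _ => rfl
  · intro c _
    simp only [Finset.mem_sigma, Finset.mem_range, mem_positiveTuples]
    exact ⟨Nat.lt_succ_of_le c.length_le, c.sum_blocksFun, c.one_le_blocksFun⟩
  · intro c _ c' _ hcc
    ext1
    rw [← c.ofFn_blocksFun, ← c'.ofFn_blocksFun]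
    exact congrArg (fun p : (k : ℕ) × (Fin k → ℕ) => List.ofFn p.2) hcc
  · rintro ⟨k, l⟩ hl
    simp only [Finset.coe_sigma, Set.mem_sigma_iff, Finset.mem_coe, mem_positiveTuples] at hl
    refine ⟨⟨List.ofFn l, ?_, ?_⟩, Finset.mem_coe.2 (Finset.mem_univ _), ?_⟩
    · intro i hi
      obtain ⟨j, rfl⟩ := (List.mem_ofFn' _ _).1 hi
      exact hl.2.2 j
    · rw [List.sum_ofFn, hl.2.1]
    · have h : ∀ (c : Composition n), c.blocks = List.ofFn l →
          (⟨c.length, c.blocksFun⟩ : (k : ℕ) × (Fin k → ℕ)) = ⟨k, l⟩ := by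
        intro c hc
        rw [← List.ofFn_inj', c.ofFn_blocksFun, hc]
      exact h _ rfl

theorem coeff_univ_prod {ι : Type*} [Fintype ι] [DecidableEq ι] (F : ι → ℂ⟦X⟧) (n : ℕ) :
    coeff n (∏ i, F i) = ∑ l ∈ Finset.univ.piAntidiag n, ∏ i, coeff (l i) (F i) := by
  rw [coeff_prod]
  refine Finset.sum_nbij (fun l => ⇑l) ?_ (fun _ _ _ _ h => DFunLike.coe_injective h) ?_
    fun _ _ => rfl
  · intro l hl
    rw [Finset.mem_finsuppAntidiag] at hl
    simpa using hl.1
  · intro l hl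
    rw [Finset.mem_coe, Finset.mem_piAntidiag] at hl
    exact ⟨Finsupp.equivFunOnFinite.symm l, by simpa using hl.1, rfl⟩

/-- The weight `l 0` comes from `t d/dt` on the marked factor. Tuples with a zero entry drop out
because `exp t - 1` has no constant term. -/
theorem coeff_prod_expSubOne_mul (f : X → ℝ) {r : ℕ} (x : Fin (r + 1) → X) (n : ℕ) :
    coeff n (eulerDeriv (expSubOne f (x 0)) * ∏ i : Fin r, expSubOne f (x i.succ)) =
      ∑ l ∈ positiveTuples (r + 1) n, (l 0 : ℂ) / (∏ i, ((l i).factorial : ℂ)) *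
        ∏ i, (f (x i) : ℂ) ^ l i := by
  have h1 : eulerDeriv (expSubOne f (x 0)) * ∏ i : Fin r, expSubOne f (x i.succ) =
      ∏ i : Fin (r + 1), if i = 0 then eulerDeriv (expSubOne f (x i)) else expSubOne f (x i) := by
    rw [Fin.prod_univ_succ]
    simp [Fin.succ_ne_zero]
  have h2 : ∀ l : Fin (r + 1) → ℕ, ∏ i : Fin (r + 1), coeff (l i)
      (if i = 0 then eulerDeriv (expSubOne f (x i)) else expSubOne f (x i)) =
      l 0 * (∏ i, expSubOneCoeff (l i)) * ∏ i, (f (x i) : ℂ) ^ l i := by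
    intro l
    rw [Fin.prod_univ_succ, Fin.prod_univ_succ (fun i => expSubOneCoeff (l i)),
      Fin.prod_univ_succ (fun i => (f (x i) : ℂ) ^ l i)]
    simp only [Fin.succ_ne_zero, if_false, if_true, coeff_eulerDeriv, coeff_expSubOne,
      Finset.prod_mul_distrib]
    ring
  rw [h1, coeff_univ_prod, positiveTuples, Finset.sum_filter]
  refine Finset.sum_congr rfl fun l _ => ?_
  rw [h2]
  split_ifs with hl
  · have : ∏ i, expSubOneCoeff (l i) = 1 / ∏ i, ((l i).factorial : ℂ) := by
      rw [one_div, ← Finset.prod_inv_distrib]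
      exact Finset.prod_congr rfl fun i _ => (if_neg (hl i).ne').trans (one_div _)
    rw [this]
    ring
  · push Not at hl
    obtain ⟨i, hi⟩ := hl
    have : ∏ i, expSubOneCoeff (l i) = 0 :=
      Finset.prod_eq_zero (Finset.mem_univ i) (if_pos (Nat.le_zero.1 hi))
    rw [this]
    ring

theorem comp_perm_mem_positiveTuples {k n : ℕ} {l : Fin k → ℕ} (τ : Equiv.Perm (Fin k)) :
    l ∘ τ ∈ positiveTuples k n ↔ l ∈ positiveTuples k n := by
  simp only [mem_positiveTuples, Function.comp_apply, Equiv.sum_comp τ]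
  exact and_congr_right fun _ => τ.forall_congr_right (q := fun i => 0 < l i)

variable [MeasurableSpace X] {K : X → X → Matrix (Fin 2) (Fin 2) ℂ} {ν : Measure X}
  [SigmaFinite ν] {f : X → ℝ}

/-- Under `hI` the cycle term may be split into its `r!` orderings. Each gives the same integral
after renaming the variables. -/
theorem coeff_cycleSeries {n r : ℕ} (hI : ∀ l ∈ positiveTuples (r + 1) n,
      Integrable (cumulantIntegrand f K l) (Measure.pi fun _ => ν)) :
    coeff n (cycleSeries K ν (expSubOne f) r) = 1 / 2 * (-1) ^ r * (r.factorial : ℂ) *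
      ∑ l ∈ positiveTuples (r + 1) n, (l 0 : ℂ) / (∏ i, ((l i).factorial : ℂ)) *
        ∫ x, cumulantIntegrand f K l x ∂(Measure.pi fun _ => ν) := by
  set V : (Fin (r + 1) → X) → ℂ := fun x => ∑ l ∈ positiveTuples (r + 1) n,
    (l 0 : ℂ) / (∏ i, ((l i).factorial : ℂ)) * cumulantIntegrand f K l x with hV
  set W : X × (Fin r → X) → ℂ := fun p =>
    coeff n (eulerDeriv (expSubOne f p.1) * ∏ i, expSubOne f (p.2 i)) *
      (pathProd K p.1 p.1 (List.ofFn p.2)).trace with hW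
  have hVint : Integrable V (Measure.pi fun _ => ν) :=
    integrable_finsetSum _ fun l hl => (hI l hl).const_mul _
  have hWV : ∀ p, W p = V (consEquiv r p) := by
    intro p
    have h := coeff_prod_expSubOne_mul f (Fin.cons p.1 p.2 : Fin (r + 1) → X) n
    simp only [Fin.cons_zero, Fin.cons_succ] at h
    simp only [hW, hV, h, consEquiv_apply, cumulantIntegrand, cycleTrace_cons, Finset.sum_mul,
      mul_assoc]
  have hWint : Integrable W (ν.prod (Measure.pi fun _ => ν)) := by
    have := ((measurePreserving_consEquiv ν r).integrable_comp_emb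
      (consEquiv r).measurableEmbedding).2 hVint
    exact this.congr (ae_of_all _ fun p => (hWV p).symm)
  have hWeq : ∫ p, W p ∂(ν.prod (Measure.pi fun _ => ν)) =
      ∑ l ∈ positiveTuples (r + 1) n, (l 0 : ℂ) / (∏ i, ((l i).factorial : ℂ)) *
        ∫ x, cumulantIntegrand f K l x ∂(Measure.pi fun _ => ν) := by
    simp only [hWV]
    rw [(measurePreserving_consEquiv ν r).integral_comp' V, hV,
      integral_finsetSum _ fun l hl => (hI l hl).const_mul _]
    exact Finset.sum_congr rfl fun l _ => integral_const_mul _ _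
  have h1 : ∀ p : X × (Fin r → X),
      coeff n (eulerDeriv (expSubOne f p.1) * ∏ i, expSubOne f (p.2 i)) *
        cyclePfaffian K p.1 (List.ofFn p.2) =
      1 / 2 * (-1) ^ r * ∑ σ : Equiv.Perm (Fin r), W (consReindexEquiv X σ p) := by
    intro p
    rw [cyclePfaffian_ofFn, mul_left_comm, Finset.mul_sum]
    congr 1
    refine Finset.sum_congr rfl fun σ _ => ?_
    simp only [hW, consReindexEquiv_apply]
    congr 3
    exact (Equiv.prod_comp σ fun i => expSubOne f (p.2 i)).symm
  have hσ : ∀ σ : Equiv.Perm (Fin r), Integrable (fun p => W (consReindexEquiv X σ p))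
      (ν.prod (Measure.pi fun _ => ν)) := fun σ =>
    ((measurePreserving_consReindexEquiv σ).integrable_comp_emb
      (consReindexEquiv X σ).measurableEmbedding).2 hWint
  rw [cycleSeries, coeff_coeffIntegral]
  simp only [h1]
  rw [integral_const_mul, integral_finsetSum _ fun σ _ => hσ σ]
  simp only [(measurePreserving_consReindexEquiv _).integral_comp' W, hWeq]
  rw [Finset.sum_const, Finset.card_univ, Fintype.card_perm, Fintype.card_fin, nsmul_eq_mul]
  ring

theorem integral_cumulantIntegrand_comp_finRotate {r : ℕ} (l : Fin (r + 1) → ℕ) :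
    ∫ x, cumulantIntegrand f K (l ∘ finRotate (r + 1)) x ∂(Measure.pi fun _ => ν) =
      ∫ x, cumulantIntegrand f K l x ∂(Measure.pi fun _ => ν) := by
  rw [← (measurePreserving_reindexEquiv ν (finRotate (r + 1))).integral_comp']
  congr 1
  ext x
  rw [reindexEquiv_apply, cumulantIntegrand, cumulantIntegrand, cycleTrace_comp_finRotate]
  congr 1
  exact Equiv.prod_comp (finRotate (r + 1)) fun i => (f (x i) : ℂ) ^ l i

/-- Rotating `l` changes neither the factorials nor the integral, by cyclicity of the trace. So `l
0` may be replaced by the average of the `l i`, which is `n / (r + 1)`. -/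
theorem sum_positiveTuples_rotate {n r : ℕ} :
    ∑ l ∈ positiveTuples (r + 1) n, (l 0 : ℂ) / (∏ i, ((l i).factorial : ℂ)) *
        ∫ x, cumulantIntegrand f K l x ∂(Measure.pi fun _ => ν) =
      n / (r + 1 : ℂ) * ∑ l ∈ positiveTuples (r + 1) n, 1 / (∏ i, ((l i).factorial : ℂ)) *
        ∫ x, cumulantIntegrand f K l x ∂(Measure.pi fun _ => ν) := by
  set S : Fin (r + 1) → ℂ := fun i => ∑ l ∈ positiveTuples (r + 1) n,
    (l i : ℂ) / (∏ i, ((l i).factorial : ℂ)) *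
      ∫ x, cumulantIntegrand f K l x ∂(Measure.pi fun _ => ν) with hS
  have hstep : ∀ i : Fin r, S i.succ = S i.castSucc := by
    intro i
    refine Finset.sum_nbij' (fun l => l ∘ finRotate (r + 1)) (fun l => l ∘ (finRotate (r + 1)).symm)
      (fun l hl => (comp_perm_mem_positiveTuples _).2 hl)
      (fun l hl => (comp_perm_mem_positiveTuples _).2 hl) (fun l _ => ?_) (fun l _ => ?_)
      fun l _ => ?_
    · ext j; simp
    · ext j; simp
    · rw [integral_cumulantIntegrand_comp_finRotate, Function.comp_apply, finRotate_castSucc]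
      congr 2
      exact (Equiv.prod_comp (finRotate (r + 1)) fun i => ((l i).factorial : ℂ)).symm
  have hconst : ∀ i, S i = S 0 := fun i =>
    Fin.induction rfl (fun i hi => (hstep i).trans hi) i
  have hsum : ∑ i, S i = n * ∑ l ∈ positiveTuples (r + 1) n, 1 / (∏ i, ((l i).factorial : ℂ)) *
        ∫ x, cumulantIntegrand f K l x ∂(Measure.pi fun _ => ν) := by
    rw [hS, Finset.sum_comm, Finset.mul_sum]
    refine Finset.sum_congr rfl fun l hl => ?_
    rw [← Finset.sum_mul, ← Finset.sum_div, ← (mem_positiveTuples.1 hl).1]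
    push_cast
    ring
  simp only [hconst, Finset.sum_const, Finset.card_univ, Fintype.card_fin, nsmul_eq_mul] at hsum
  have h0 : (r + 1 : ℂ) ≠ 0 := by exact_mod_cast r.succ_ne_zero
  push_cast at hsum
  change S 0 = _
  rw [div_mul_eq_mul_div, ← hsum]
  field_simp

theorem coeff_cumulantSeries {n : ℕ} (hn : 0 < n)
    (hI : ∀ c : Composition n,
      Integrable (cumulantIntegrand f K c.blocksFun) (Measure.pi fun _ => ν)) :
    ((n - 1).factorial : ℂ) * coeff n (cumulantSeries K ν (expSubOne f)) =
      1 / 2 * ∑ c : Composition n,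
        (-1 : ℂ) ^ (c.length - 1) *
          ((n.factorial : ℂ) / ∏ i : Fin c.length, ((c.blocksFun i).factorial : ℂ)) *
          (1 / (c.length : ℂ)) *
          ∫ x, cumulantIntegrand f K c.blocksFun x ∂(Measure.pi fun _ : Fin c.length => ν) := by
  have hI' : ∀ (k : ℕ), ∀ l ∈ positiveTuples k n,
      Integrable (cumulantIntegrand f K l) (Measure.pi fun _ => ν) := by
    intro k l hl
    -- Tuples whose lengths are not definitionally equal are compared through their lists.
    have h : ∀ (k' : ℕ) (l' : Fin k' → ℕ), List.ofFn l' = List.ofFn l →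
        Integrable (cumulantIntegrand f K l') (Measure.pi fun _ => ν) →
        Integrable (cumulantIntegrand f K l) (Measure.pi fun _ => ν) := by
      intro k' l' h hint
      rw [List.ofFn_inj'] at h
      cases h
      exact hint
    rw [mem_positiveTuples] at hl
    let c : Composition n := ⟨List.ofFn l, fun {i} hi => by
      obtain ⟨j, rfl⟩ := (List.mem_ofFn' _ _).1 hi
      exact hl.2 j, by rw [List.sum_ofFn, hl.1]⟩
    exact h c.length c.blocksFun c.ofFn_blocksFun (hI c)
  rw [sum_composition (fun k l => (-1 : ℂ) ^ (k - 1) *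
    ((n.factorial : ℂ) / ∏ i : Fin k, ((l i).factorial : ℂ)) * (1 / (k : ℂ)) *
      ∫ x, cumulantIntegrand f K l x ∂(Measure.pi fun _ : Fin k => ν)) hn, cumulantSeries, coeff_mk,
    Finset.mul_sum, Finset.mul_sum]
  refine Finset.sum_congr rfl fun r _ => ?_
  rw [coeff_smul, smul_eq_mul, coeff_cycleSeries (hI' (r + 1)), sum_positiveTuples_rotate]
  obtain ⟨m, rfl⟩ := Nat.exists_eq_succ_of_ne_zero hn.ne'
  have h1 : (r.factorial : ℂ) ≠ 0 := by exact_mod_cast r.factorial_ne_zero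
  have h0 : (r + 1 : ℂ) ≠ 0 := by exact_mod_cast r.succ_ne_zero
  simp only [Nat.succ_eq_add_one, Nat.add_sub_cancel, Nat.factorial_succ, Nat.cast_mul,
    Nat.cast_add, Nat.cast_one, Finset.mul_sum]
  refine Finset.sum_congr rfl fun l _ => ?_
  field_simp

end CompositionSum

/-! ### Taylor series of the characteristic function and of its logarithm -/

section Cumulants

open PowerSeries

/-- The Taylor series at `0`. -/
def taylorSeriesAtZero (g : ℝ → ℂ) : ℂ⟦X⟧ :=
  PowerSeries.mk fun n => iteratedDeriv n g 0 / (n.factorial : ℂ)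

theorem contDiffAt_clog {g : ℝ → ℂ} {n : WithTop ℕ∞} {t : ℝ} (hg : ContDiffAt ℝ n g t)
    (h0 : g t ∈ Complex.slitPlane) : ContDiffAt ℝ n (fun t => Complex.log (g t)) t :=
  ((Complex.contDiffAt_log h0).restrict_scalars ℝ).comp t hg

/-- Near `0` the values of `g` stay in the slit plane, so `g' = g (log g)'` there. Leibniz's formula
divided by the factorials is the Cauchy product. -/
theorem derivative_taylorSeriesAtZero {g : ℝ → ℂ} (hg : ContDiff ℝ (⊤ : ℕ∞) g) (h0 : g 0 = 1) :
    PowerSeries.derivative ℂ (taylorSeriesAtZero g) = taylorSeriesAtZero g *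
      PowerSeries.derivative ℂ (taylorSeriesAtZero fun t => Complex.log (g t)) := by
  set L : ℝ → ℂ := fun t => Complex.log (g t) with hL
  have hslit : ∀ᶠ t in 𝓝 (0 : ℝ), g t ∈ Complex.slitPlane := by
    refine hg.continuous.continuousAt.eventually_mem (Complex.isOpen_slitPlane.mem_nhds ?_)
    rw [h0]
    exact Complex.one_mem_slitPlane
  have hLc : ContDiffAt ℝ (⊤ : ℕ∞) L 0 := contDiffAt_clog hg.contDiffAt hslit.self_of_nhds
  have hdL : ∀ n : ℕ, ContDiffAt ℝ n (deriv L) 0 := by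
    intro n
    have h : ContDiffAt ℝ n (fderiv ℝ L) 0 :=
      hLc.fderiv_right (by exact_mod_cast (le_top : ((n + 1 : ℕ) : ℕ∞) ≤ ⊤))
    have : deriv L = fun x => fderiv ℝ L x 1 := by
      ext x
      simp
    rw [this]
    exact h.clm_apply contDiffAt_const
  have hgL : deriv g =ᶠ[𝓝 0] g * deriv L := by
    filter_upwards [hslit] with t ht
    have h1 : HasDerivAt g (deriv g t) t :=
      (hg.differentiable (by simp)).differentiableAt.hasDerivAt
    have h2 : deriv L t = deriv g t / g t := (h1.clog_real ht).deriv
    have h3 : g t ≠ 0 := Complex.slitPlane_ne_zero ht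
    rw [Pi.mul_apply, h2, mul_div_cancel₀ _ h3]
  ext n
  rw [coeff_derivative, coeff_mul, taylorSeriesAtZero, coeff_mk, iteratedDeriv_succ',
    hgL.iteratedDeriv_eq, iteratedDeriv_mul (hg.contDiffAt.of_le (by exact_mod_cast le_top))
      (hdL n), Finset.Nat.sum_antidiagonal_eq_sum_range_succ (fun i j =>
      coeff i (PowerSeries.mk fun n => iteratedDeriv n g 0 / (n.factorial : ℂ)) *
        coeff j (PowerSeries.derivative ℂ (taylorSeriesAtZero L))), Finset.sum_div,
      Finset.sum_mul]
  refine Finset.sum_congr rfl fun i hi => ?_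
  have hi := Nat.lt_succ_iff.1 (Finset.mem_range.1 hi)
  rw [coeff_derivative, coeff_mk, taylorSeriesAtZero, coeff_mk, iteratedDeriv_succ',
    Nat.choose_eq_factorial_div_factorial hi,
    Nat.cast_div (Nat.factorial_mul_factorial_dvd_factorial hi)
      (by exact_mod_cast (mul_pos i.factorial_pos (n - i).factorial_pos).ne'),
    Nat.factorial_succ, Nat.factorial_succ]
  have h1 : (i.factorial : ℂ) ≠ 0 := by exact_mod_cast i.factorial_ne_zero
  have h2 : ((n - i).factorial : ℂ) ≠ 0 := by exact_mod_cast (n - i).factorial_ne_zero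
  have h3 : (n.factorial : ℂ) ≠ 0 := by exact_mod_cast n.factorial_ne_zero
  have h4 : (n + 1 : ℂ) ≠ 0 := by exact_mod_cast n.succ_ne_zero
  have h5 : ((n - i : ℕ) + 1 : ℂ) ≠ 0 := by exact_mod_cast (n - i).succ_ne_zero
  push_cast
  field_simp

theorem eulerDeriv_rescale (a : ℂ) (F : ℂ⟦X⟧) :
    eulerDeriv (rescale a F) = rescale a (eulerDeriv F) := by
  ext n
  simp only [coeff_eulerDeriv, coeff_rescale]
  ring

/-- The cumulants are determined by the logarithmic derivative of the generating series of the
moments. -/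
theorem cumulant_eq_of_eulerDeriv_eq {Ω : Type*} [MeasurableSpace Ω] {P : Measure Ω}
    [IsProbabilityMeasure P] {η : Ω → ℝ} (hη : Measurable η)
    (hmom : ∀ p : ℕ, MemLp η (p : ℝ≥0∞) P) {a c : ℂ⟦X⟧}
    (ha : ∀ n, coeff n a = (∫ ω, η ω ^ n ∂P : ℝ) / (n.factorial : ℂ))
    (hac : eulerDeriv a = c * a) {n : ℕ} (hn : 0 < n) :
    cumulant P η n = ((n - 1).factorial : ℂ) * coeff n c := by
  have : IsProbabilityMeasure (P.map η) := Measure.isProbabilityMeasure_map hη.aemeasurable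
  have hid : ∀ p : ℕ, MemLp id (p : ℝ≥0∞) (P.map η) := fun p =>
    (memLp_map_measure_iff aestronglyMeasurable_id hη.aemeasurable).2 (hmom p)
  have hφ : taylorSeriesAtZero (charFun (P.map η)) = rescale Complex.I a := by
    ext m
    rw [taylorSeriesAtZero, coeff_mk, coeff_rescale, ha, iteratedDeriv_charFun_zero (hid m),
      integral_map hη.aemeasurable (by fun_prop)]
    ring
  have h1 := derivative_taylorSeriesAtZero (contDiff_charFun' hid) (by simp)
  set L := taylorSeriesAtZero fun t => Complex.log (charFun (P.map η) t) with hL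
  -- Both `L` and the rescaled `c` are logarithmic derivatives of the same series up to `t d/dt`;
  -- that series has constant term `1` and can be cancelled.
  have h2 : eulerDeriv L * rescale Complex.I a = rescale Complex.I c * rescale Complex.I a := by
    rw [← map_mul, ← hac, ← eulerDeriv_rescale, ← hφ, eulerDeriv, eulerDeriv, h1]
    ring
  have ha0 : rescale Complex.I a ≠ 0 := by
    intro h
    have := congrArg (coeff 0) h
    rw [coeff_rescale, ha] at this
    simp at this
  have h3 := congrArg (coeff n) (mul_right_cancel₀ ha0 h2)
  rw [coeff_eulerDeriv, coeff_rescale, hL, taylorSeriesAtZero, coeff_mk] at h3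
  have hI : Complex.I ^ n ≠ 0 := pow_ne_zero _ Complex.I_ne_zero
  rw [cumulant, div_eq_iff hI]
  obtain ⟨m, rfl⟩ := Nat.exists_eq_succ_of_ne_zero hn.ne'
  have hm : (m.factorial : ℂ) ≠ 0 := by exact_mod_cast m.factorial_ne_zero
  have hm1 : (m + 1 : ℂ) ≠ 0 := by exact_mod_cast m.succ_ne_zero
  rw [Nat.succ_eq_add_one, Nat.add_sub_cancel]
  rw [Nat.succ_eq_add_one, Nat.factorial_succ] at h3
  push_cast at h3
  field_simp at h3
  rw [h3]
  ring

end Cumulants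

/-! ### Powers of weighted counts in terms of falling factorials -/

section FallingFactorials

open PowerSeries

variable {ι : Type*} [Fintype ι] [DecidableEq ι]

/-- The number of indices with a given value. -/
def fiberCard {k : ℕ} (j : Fin k → ι) (a : ι) : ℕ := (Finset.univ.filter fun i => j i = a).card

/-- The linear map `Φ` sending the monomial with exponents `κ` to `F κ` is applied to two expansions
of `(∑ X_a)^k`: over words, and by the multinomial theorem. -/
theorem sum_fiberCard {M : Type*} [AddCommGroup M] [Module ℂ M] (F : (ι → ℕ) → M) (k : ℕ) :
    ∑ j : Fin k → ι, F (fiberCard j) =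
      ∑ κ ∈ (Finset.univ : Finset ι).piAntidiag k,
        (Nat.multinomial Finset.univ κ : ℂ) • F κ := by
  let Φ : MvPolynomial ι ℂ →ₗ[ℂ] M := (MvPolynomial.basisMonomials ι ℂ).constr ℂ fun s => F ⇑s
  have hΦ : ∀ s, Φ (MvPolynomial.monomial s 1) = F ⇑s := fun s => by
    have := (MvPolynomial.basisMonomials ι ℂ).constr_basis ℂ (fun s => F ⇑s) s
    rwa [MvPolynomial.coe_basisMonomials] at this
  have h := Finset.sum_pow_eq_sum_piAntidiag (Finset.univ : Finset ι)
    (fun a => (MvPolynomial.X a : MvPolynomial ι ℂ)) k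
  rw [Fintype.sum_pow] at h
  have h' := congrArg Φ h
  rw [map_sum, map_sum] at h'
  have hl : ∀ j : Fin k → ι, F (fiberCard j) =
      Φ (∏ i, (MvPolynomial.X (j i) : MvPolynomial ι ℂ)) := by
    intro j
    have : ∏ i, (MvPolynomial.X (j i) : MvPolynomial ι ℂ) =
        MvPolynomial.monomial (∑ i, Finsupp.single (j i) 1) 1 := by
      rw [MvPolynomial.monomial_sum_one]
      rfl
    rw [this, hΦ]
    congr 1
    ext a
    simp [fiberCard, Finsupp.single_apply]
  have hr : ∀ κ : ι → ℕ, (Nat.multinomial Finset.univ κ : ℂ) • F κ =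
      Φ ((Nat.multinomial Finset.univ κ : MvPolynomial ι ℂ) *
        ∏ a, (MvPolynomial.X a : MvPolynomial ι ℂ) ^ κ a) := by
    intro κ
    have : (Nat.multinomial Finset.univ κ : MvPolynomial ι ℂ) *
        ∏ a, (MvPolynomial.X a : MvPolynomial ι ℂ) ^ κ a =
        (Nat.multinomial Finset.univ κ : ℂ) •
          MvPolynomial.monomial (Finsupp.equivFunOnFinite.symm κ) 1 := by
      have hκ : (Finsupp.indicator Finset.univ fun i _ => κ i) =
          Finsupp.equivFunOnFinite.symm κ := by
        ext a
        simp
      rw [MvPolynomial.prod_X_pow, MvPolynomial.smul_eq_C_mul, hκ, map_natCast]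
    rw [this, map_smul, hΦ]
    rfl
  simp only [hl, hr]
  exact h'

theorem sum_prod_choose (N : ι → ℕ) (g : ι → ℂ⟦X⟧) (k : ℕ) :
    ∑ κ ∈ (Finset.univ : Finset ι).piAntidiag k, ∏ a, (((N a).choose (κ a) : ℂ) • g a ^ κ a) =
      (1 / (k.factorial : ℂ)) • ∑ j : Fin k → ι,
        ((∏ a, (N a).descFactorial (fiberCard j a) : ℕ) : ℂ) • ∏ i, g (j i) := by
  have hg : ∀ j : Fin k → ι, ∏ i, g (j i) = ∏ a, g a ^ fiberCard j a := fun j => by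
    rw [← Finset.prod_fiberwise' Finset.univ j g]
    simp [fiberCard]
  simp only [hg]
  rw [sum_fiberCard (fun κ => ((∏ a, (N a).descFactorial (κ a) : ℕ) : ℂ) • ∏ a, g a ^ κ a),
    Finset.smul_sum]
  refine Finset.sum_congr rfl fun κ hκ => ?_
  rw [smul_smul, smul_smul, Finset.prod_smul]
  congr 1
  have h1 := Nat.multinomial_spec Finset.univ κ
  rw [show ∑ a, κ a = k by simpa using hκ] at h1
  have hk : (k.factorial : ℂ) ≠ 0 := by exact_mod_cast k.factorial_ne_zero
  have h2 : ((∏ a, (N a).descFactorial (κ a) : ℕ) : ℂ) =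
      (∏ a, ((κ a).factorial : ℂ)) * ∏ a, ((N a).choose (κ a) : ℂ) := by
    rw [← Finset.prod_mul_distrib]
    push_cast
    refine Finset.prod_congr rfl fun a _ => ?_
    rw [Nat.descFactorial_eq_factorial_mul_choose]
    push_cast
    rfl
  have h3 : (∏ a, ((κ a).factorial : ℂ)) * (Nat.multinomial Finset.univ κ : ℂ) =
      (k.factorial : ℂ) := by exact_mod_cast h1
  rw [h2]
  calc _ = 1 / (k.factorial : ℂ) * k.factorial * ∏ a, ((N a).choose (κ a) : ℂ) := by
        field_simp
    _ = _ := by rw [← h3]; ring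

theorem prod_one_add_pow (N : ι → ℕ) (g : ι → ℂ⟦X⟧) {M : ℕ} (hM : ∑ a, N a ≤ M) :
    ∏ a, (1 + g a) ^ N a = ∑ k ∈ Finset.range (M + 1),
      (1 / (k.factorial : ℂ)) • ∑ j : Fin k → ι,
        ((∏ a, (N a).descFactorial (fiberCard j a) : ℕ) : ℂ) • ∏ i, g (j i) := by
  have h1 : ∀ a, (1 + g a) ^ N a =
      ∑ m ∈ Finset.range (N a + 1), ((N a).choose m : ℂ) • g a ^ m := fun a => by
    rw [add_comm, add_pow]
    refine Finset.sum_congr rfl fun m _ => ?_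
    rw [one_pow, mul_one, mul_comm, PowerSeries.smul_eq_C_mul, map_natCast]
  simp only [h1, ← sum_prod_choose]
  rw [Finset.prod_univ_sum, ← Finset.sum_fiberwise_of_maps_to
    (t := Finset.range (M + 1)) (g := fun κ : ι → ℕ => ∑ a, κ a)]
  · refine Finset.sum_congr rfl fun k _ => ?_
    refine Finset.sum_subset (fun κ hκ => ?_) fun κ hκ hκ' => ?_
    · simpa using (Finset.mem_filter.1 hκ).2
    · have hs : ∑ a, κ a = k := by simpa using hκ
      simp only [Finset.mem_filter, hs, and_true, Fintype.mem_piFinset, Finset.mem_range,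
        not_forall, not_lt] at hκ'
      obtain ⟨a, ha⟩ := hκ'
      refine Finset.prod_eq_zero (Finset.mem_univ a) ?_
      rw [Nat.choose_eq_zero_of_lt (by omega), Nat.cast_zero, zero_smul]
  · intro κ hκ
    rw [Fintype.mem_piFinset] at hκ
    rw [Finset.mem_range]
    refine Nat.lt_succ_of_le (le_trans (Finset.sum_le_sum fun a _ => ?_) hM)
    exact Nat.lt_succ_iff.1 (Finset.mem_range.1 (hκ a))

/-- As `X` divides each `g a`, the range of `k` can be cut at `n` whatever `N` is. This uniformity
matters because `N` will be the random vector of counts. -/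
theorem coeff_prod_one_add_pow (N : ι → ℕ) {g : ι → ℂ⟦X⟧}
    (hg : ∀ a, (PowerSeries.X : ℂ⟦X⟧) ∣ g a) (n : ℕ) :
    coeff n (∏ a, (1 + g a) ^ N a) = ∑ k ∈ Finset.range (n + 1),
      1 / (k.factorial : ℂ) * ∑ j : Fin k → ι,
        coeff n (∏ i, g (j i)) * ((∏ a, (N a).descFactorial (fiberCard j a) : ℕ) : ℂ) := by
  rw [prod_one_add_pow N g (le_max_left _ n), map_sum]
  simp only [coeff_smul, map_sum, smul_eq_mul]
  symm
  have h : ∀ k, 1 / (k.factorial : ℂ) * ∑ j : Fin k → ι,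
        coeff n (∏ i, g (j i)) * ((∏ a, (N a).descFactorial (fiberCard j a) : ℕ) : ℂ) =
      1 / (k.factorial : ℂ) * ∑ j : Fin k → ι,
        ((∏ a, (N a).descFactorial (fiberCard j a) : ℕ) : ℂ) * coeff n (∏ i, g (j i)) :=
    fun k => by
      congr 1
      exact Finset.sum_congr rfl fun j _ => mul_comm _ _
  simp only [h]
  refine Finset.sum_subset (Finset.range_mono (by omega)) fun k _ hk => ?_
  rw [Finset.sum_eq_zero, mul_zero]
  intro j _
  rw [PowerSeries.X_pow_dvd_iff.1 (X_pow_dvd_prod hg j) n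
    (by rw [Finset.mem_range] at hk; omega), mul_zero]

theorem one_add_expSubOne {X : Type*} (f : X → ℝ) (x : X) :
    1 + expSubOne f x = rescale (f x : ℂ) (PowerSeries.exp ℂ) := by
  rw [expSubOne, add_sub_cancel]

theorem X_dvd_expSubOne {X : Type*} (f : X → ℝ) (x : X) :
    (PowerSeries.X : ℂ⟦X⟧) ∣ expSubOne f x := by
  rw [PowerSeries.X_dvd_iff, ← coeff_zero_eq_constantCoeff_apply, coeff_expSubOne,
    expSubOneCoeff, if_pos rfl, zero_mul]

theorem prod_rescale_exp_pow (N : ι → ℕ) (c : ι → ℂ) :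
    ∏ a, rescale (c a) (PowerSeries.exp ℂ) ^ N a =
      rescale (∑ a, c a * N a) (PowerSeries.exp ℂ) := by
  have h1 : ∀ (b : ℂ) (m : ℕ), rescale b (PowerSeries.exp ℂ) ^ m =
      rescale (b * m) (PowerSeries.exp ℂ) := fun b m => by
    rw [← map_pow, exp_pow_eq_rescale_exp, rescale_rescale, mul_comm]
  have h2 : ∀ s : Finset ι, ∏ a ∈ s, rescale (c a * N a) (PowerSeries.exp ℂ) =
      rescale (∑ a ∈ s, c a * N a) (PowerSeries.exp ℂ) := fun s => by
    induction s using Finset.induction_on with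
    | empty => simp [PowerSeries.rescale_zero]
    | insert a s ha ih =>
      rw [Finset.prod_insert ha, Finset.sum_insert ha, ih, exp_mul_exp_eq_exp_add]
  simp only [h1, h2]

/-- The powers of a weighted sum of natural numbers in terms of falling factorials. -/
theorem sum_pow_div_factorial {Y : Type*} (N : ι → ℕ) (c : Y → ℝ) (y : ι → Y) (n : ℕ) :
    (∑ a, (c (y a) : ℂ) * N a) ^ n / (n.factorial : ℂ) = ∑ k ∈ Finset.range (n + 1),
      1 / (k.factorial : ℂ) * ∑ j : Fin k → ι, coeff n (∏ i, expSubOne c (y (j i))) *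
        ((∏ a, (N a).descFactorial (fiberCard j a) : ℕ) : ℂ) := by
  rw [← coeff_prod_one_add_pow N (fun a => X_dvd_expSubOne c (y a))]
  simp only [one_add_expSubOne, prod_rescale_exp_pow, coeff_rescale, coeff_exp]
  simp [div_eq_mul_inv]

end FallingFactorials

/-! ### Integrality of counts and bounds by falling factorials -/

section CountProperties

theorem prod_range_cast_sub (N k : ℕ) :
    ∏ i ∈ Finset.range k, ((N : ℝ) - i) = (N.descFactorial k : ℝ) := by
  induction k with
  | zero => simp
  | succ k ih =>
    rw [Finset.prod_range_succ, ih, Nat.descFactorial_succ]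
    rcases le_or_gt k N with h | h
    · push_cast [Nat.cast_sub h]
      ring
    · rw [Nat.descFactorial_eq_zero_iff_lt.2 h]
      simp

/-- If `2p ≤ N`, every factor of the falling factorial is at least `N / 2`; otherwise `N^p` is at
most `(2p)^p`. Factorial moments thus control ordinary moments. -/
theorem pow_le_add_descFactorial (N p : ℕ) :
    (N : ℝ) ^ p ≤ (2 * p : ℝ) ^ p + 2 ^ p * (N.descFactorial p : ℝ) := by
  rcases le_or_gt (2 * p) N with h | h
  · have h1 : ((N : ℝ) / 2) ^ p ≤ (N.descFactorial p : ℝ) := by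
      rw [← prod_range_cast_sub, ← Finset.card_range p, ← Finset.prod_const, Finset.card_range]
      refine Finset.prod_le_prod (fun _ _ => by positivity) fun i hi => ?_
      have h2 : 2 * i ≤ N := by have := Finset.mem_range.1 hi; omega
      have h3 : (2 * i : ℝ) ≤ N := by exact_mod_cast h2
      linarith
    calc (N : ℝ) ^ p = 2 ^ p * ((N : ℝ) / 2) ^ p := by rw [← mul_pow]; congr 1; ring
      _ ≤ 2 ^ p * (N.descFactorial p : ℝ) := by gcongr
      _ ≤ _ := le_add_of_nonneg_left (by positivity)
  · calc (N : ℝ) ^ p ≤ (2 * p : ℝ) ^ p := by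
          gcongr
          exact_mod_cast h.le
      _ ≤ _ := le_add_of_nonneg_right (by positivity)

theorem Conf.exists_count_eq_natCast {X : Type*} [TopologicalSpace X] [MeasurableSpace X]
    (ξ : Conf X) {A : Set X} (hA : MeasurableSet A) (hfin : ξ.toMeasure A ≠ ∞) :
    ∃ N : ℕ, ξ.count A = N := by
  obtain ⟨ι, _, x, hx⟩ := ξ.exists_eq_sum_dirac
  have h1 : ξ.toMeasure A = ((x ⁻¹' A).encard : ℝ≥0∞) := by
    rw [hx, Measure.sum_apply _ hA, ← ENNReal.tsum_set_one,
      tsum_subtype (x ⁻¹' A) fun _ => (1 : ℝ≥0∞)]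
    refine tsum_congr fun i => ?_
    rw [Measure.dirac_apply' _ hA]
    rfl
  rw [h1] at hfin
  have h2 : (x ⁻¹' A).encard ≠ ⊤ := fun h => hfin (by rw [h]; rfl)
  refine ⟨(x ⁻¹' A).encard.toNat, ?_⟩
  rw [count, Measure.real, h1]
  conv_lhs => rw [← ENat.natCast_toNat h2]
  simp

end CountProperties

/-! ### Step functions and local integrability of the Pfaffians -/

theorem step_eq_sum_indicator {X ι : Type*} [Fintype ι] {A : ι → Set X} {c : ι → ℝ} {g : X → ℝ}
    (hd : Pairwise fun a b => Disjoint (A a) (A b)) (hg : ∀ a, ∀ x ∈ A a, g x = c a)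
    (hg0 : ∀ x, (∀ a, x ∉ A a) → g x = 0) :
    g = fun x => ∑ a, (A a).indicator (fun _ => c a) x := by
  ext x
  by_cases hx : ∃ a, x ∈ A a
  · obtain ⟨a, ha⟩ := hx
    rw [Finset.sum_eq_single a, Set.indicator_of_mem ha, hg a x ha]
    · intro b _ hb
      exact Set.indicator_of_notMem (Set.disjoint_left.1 (hd hb.symm) ha) _
    · simp
  · push Not at hx
    rw [hg0 x hx, Finset.sum_eq_zero]
    exact fun a _ => Set.indicator_of_notMem (hx a) _

theorem expSubOne_of_step {X ι : Type*} [Fintype ι] [DecidableEq ι] {A : ι → Set X} {c : ι → ℝ}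
    {g : X → ℝ} (hd : Pairwise fun a b => Disjoint (A a) (A b))
    (hg : ∀ a, ∀ x ∈ A a, g x = c a) (hg0 : ∀ x, (∀ a, x ∉ A a) → g x = 0) {k : ℕ}
    (x : Fin k → X) (n : ℕ) :
    PowerSeries.coeff n (∏ i, expSubOne g (x i)) =
      ∑ j : Fin k → ι, PowerSeries.coeff n (∏ i, expSubOne id (c (j i))) *
        {x : Fin k → X | ∀ i, x i ∈ A (j i)}.indicator (fun _ => (1 : ℂ)) x := by
  classical
  have h1 : ∀ y, expSubOne g y = ∑ a, if y ∈ A a then expSubOne id (c a) else 0 := by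
    intro y
    by_cases hy : ∃ a, y ∈ A a
    · obtain ⟨a, ha⟩ := hy
      rw [Finset.sum_eq_single a, if_pos ha, expSubOne, expSubOne, hg a y ha, id]
      · intro b _ hb
        exact if_neg (Set.disjoint_left.1 (hd hb.symm) ha)
      · simp
    · push Not at hy
      rw [Finset.sum_eq_zero fun a _ => if_neg (hy a), expSubOne, hg0 y hy]
      simp [PowerSeries.rescale_zero]
  simp only [h1]
  rw [Finset.prod_univ_sum, map_sum, Fintype.piFinset_univ]
  refine Finset.sum_congr rfl fun j _ => ?_
  rw [Finset.prod_ite_zero]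
  by_cases h : x ∈ {x : Fin k → X | ∀ i, x i ∈ A (j i)}
  · rw [if_pos (fun i _ => h i), Set.indicator_of_mem h, mul_one]
  · rw [if_neg (fun h' => h fun i => h' i (Finset.mem_univ i)), Set.indicator_of_notMem h, mul_zero,
      map_zero]

theorem integrable_kernelPfaffian {X : Type*} [TopologicalSpace X] [MeasurableSpace X]
    {μ : Measure X} [SigmaFinite μ] {P : Measure (Conf X)}
    {K : X → X → Matrix (Fin 2) (Fin 2) ℂ} (hP : IsPfaffianPointProcess P μ K) [IsLocallyFiniteMeasure μ]
    {B : Set X} (hB : IsCompact B) (k : ℕ) :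
    Integrable (kernelPfaffian K : (Fin k → X) → ℂ) (Measure.pi fun _ => μ.restrict B) := by
  rcases Nat.eq_zero_or_pos k with rfl | hk
  · have : IsFiniteMeasure (μ.restrict B) := isFiniteMeasure_restrict.2 hB.measure_lt_top.ne
    have h : (kernelPfaffian K : (Fin 0 → X) → ℂ) = fun _ => 1 := by
      ext x
      exact kernelPfaffian_zero K x
    rw [h]
    exact integrable_const _
  · obtain ⟨ρ, hρ, hρK⟩ := hP.correlation k hk
    rw [← Measure.restrict_pi_pi]
    have h := hρ.locallyIntegrable.integrableOn_isCompact (isCompact_univ_pi fun _ => hB)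
    exact (Integrable.ofReal h).congr (ae_restrict_of_ae hρK)

/-! ### Factorial moments and the moment formula for step functions -/

section FactorialMoments

variable {X : Type*} [TopologicalSpace X] [PolishSpace X] [MeasurableSpace X] [BorelSpace X]
  {μ : Measure X} [SigmaFinite μ] {P : Measure (Conf X)} {K : X → X → Matrix (Fin 2) (Fin 2) ℂ}

/-- The mixed falling factorial `∏_a #_{A_a} (#_{A_a} - 1) ⋯ (#_{A_a} - κ_a + 1)`. -/
def fallingCount {ι : Type*} [Fintype ι] (A : ι → Set X) (κ : ι → ℕ) (ξ : Conf X) : ℝ :=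
  ∏ a, ∏ t ∈ Finset.range (κ a), (ξ.count (A a) - (t : ℝ))

/-- Surjectivity of `j` makes all exponents positive, as the defining identity demands. That
identity lists the coordinates set by set; symmetry of the Pfaffian permits the order given by `j`.
-/
theorem fallingCount_of_surjective (hP : IsPfaffianPointProcess P μ K) {k m : ℕ} (hk : 0 < k)
    {A : Fin m → Set X} (hA : ∀ a, IsCompact (A a))
    (hd : Pairwise fun a b => Disjoint (A a) (A b)) {j : Fin k → Fin m}
    (hj : Function.Surjective j) :
    Integrable (fallingCount A (fiberCard j)) P ∧
      ((∫ ξ, fallingCount A (fiberCard j) ξ ∂P : ℝ) : ℂ) =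
        ∫ x in {x : Fin k → X | ∀ i, x i ∈ A (j i)}, kernelPfaffian K x
          ∂(Measure.pi fun _ => μ) := by
  have hm : 0 < m := (j ⟨0, hk⟩).pos
  have hκ : ∀ a, 0 < fiberCard j a := fun a => by
    obtain ⟨i, hi⟩ := hj a
    exact Finset.card_pos.2 ⟨i, by simp [hi]⟩
  have hsum : ∑ a, fiberCard j a = k := by
    have := Finset.card_eq_sum_card_fiberwise (f := j) (s := Finset.univ) (t := Finset.univ)
      (fun _ _ => Finset.mem_coe.2 (Finset.mem_univ _))
    rw [Finset.card_univ, Fintype.card_fin] at this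
    exact this.symm
  have hAm : ∀ a, MeasurableSet (A a) := fun a => (hA a).measurableSet
  obtain ⟨ρ, hρ, hρK⟩ := hP.correlation k hk
  refine ⟨hρ.integrable_prod m _ A hm hκ hsum hA hAm hd, ?_⟩
  have h1 := hρ.integral_prod m _ A hm hκ hsum hA hAm hd
  have hcard : ∀ p, Fintype.card (Fin (fiberCard j p)) = Fintype.card {i // j i = p} := fun p => by
    rw [Fintype.card_fin, Fintype.card_subtype, fiberCard]
  let θ : (p : Fin m) × Fin (fiberCard j p) ≃ Fin k :=
    (Equiv.sigmaCongrRight fun p => Fintype.equivOfCardEq (hcard p)).trans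
      (Equiv.sigmaFiberEquiv j)
  have hθ : ∀ p, j (θ p) = p.1 := fun p =>
    (Fintype.equivOfCardEq (hcard p.1) p.2).2
  let π : Equiv.Perm (Fin k) :=
    ((finSigmaFinEquiv.trans (finCongr hsum)).symm).trans θ
  have hπ : ∀ p, π (Fin.cast hsum (finSigmaFinEquiv p)) = θ p := fun p => by
    have : Fin.cast hsum (finSigmaFinEquiv p) = (finSigmaFinEquiv.trans (finCongr hsum)) p := rfl
    rw [this, Equiv.trans_apply, Equiv.symm_apply_apply]
  have hset : {x : Fin k → X | ∀ i, x i ∈ A (j i)} = reindexEquiv π ⁻¹'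
      {x : Fin k → X | ∀ p : (i : Fin m) × Fin (fiberCard j i),
        x (Fin.cast hsum (finSigmaFinEquiv p)) ∈ A p.1} := by
    ext x
    simp only [Set.mem_preimage, Set.mem_ofPred_eq, reindexEquiv_apply, Function.comp_apply, hπ]
    rw [← θ.forall_congr_right]
    simp only [hθ]
  change ((∫ ξ, ∏ i, ∏ t ∈ Finset.range (fiberCard j i), (ξ.count (A i) - (t : ℝ)) ∂P : ℝ) : ℂ) = _
  rw [h1, hset, ← integral_complex_ofReal, integral_congr_ae (ae_restrict_of_ae hρK),
    ← (measurePreserving_reindexEquiv μ π).setIntegral_preimage_emb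
      (reindexEquiv π).measurableEmbedding]
  congr 1
  ext x
  rw [reindexEquiv_apply]
  exact kernelPfaffian_comp_perm K x π

/-- Sets not hit by `j` contribute empty products, so the family is restricted to the image of `j`.
For `k = 0` both sides are `1`. -/
theorem fallingCount_fiberCard (hP : IsPfaffianPointProcess P μ K) {ι : Type*} [Fintype ι]
    [DecidableEq ι] {A : ι → Set X} (hA : ∀ a, IsCompact (A a))
    (hd : Pairwise fun a b => Disjoint (A a) (A b)) {k : ℕ} (j : Fin k → ι) :
    Integrable (fallingCount A (fiberCard j)) P ∧
      ((∫ ξ, fallingCount A (fiberCard j) ξ ∂P : ℝ) : ℂ) =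
        ∫ x in {x : Fin k → X | ∀ i, x i ∈ A (j i)}, kernelPfaffian K x
          ∂(Measure.pi fun _ => μ) := by
  have := hP.isProbabilityMeasure
  rcases Nat.eq_zero_or_pos k with rfl | hk
  · have h1 : fallingCount A (fiberCard j) = fun _ => (1 : ℝ) := by
      ext ξ
      simp [fallingCount, fiberCard]
    rw [h1]
    refine ⟨integrable_const _, ?_⟩
    simp [kernelPfaffian_zero, Measure.real]
  · set S := Finset.univ.image j with hS
    let e := S.equivFin
    let j' : Fin k → Fin S.card := fun i => e ⟨j i, Finset.mem_image_of_mem j (Finset.mem_univ i)⟩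
    let emb : Fin S.card ↪ ι := e.symm.toEmbedding.trans (Function.Embedding.subtype _)
    have hj' : ∀ i, emb (j' i) = j i := fun i => by simp [emb, j']
    have hsurj : Function.Surjective j' := by
      intro p
      obtain ⟨i, -, hi⟩ := Finset.mem_image.1 (e.symm p).2
      refine ⟨i, ?_⟩
      rw [← e.symm.injective.eq_iff]
      ext
      simp [j', hi]
    have hfib : ∀ p, fiberCard j (emb p) = fiberCard j' p := fun p => by
      simp only [fiberCard, ← hj', emb.injective.eq_iff]
    have hcount : fallingCount A (fiberCard j) =
        fallingCount (fun p => A (emb p)) (fiberCard j') := by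
      ext ξ
      simp only [fallingCount]
      rw [← Finset.prod_subset (Finset.subset_univ (Finset.univ.map emb)), Finset.prod_map]
      · simp only [hfib]
      · intro a _ ha
        have : fiberCard j a = 0 := by
          rw [fiberCard, Finset.card_eq_zero, Finset.filter_eq_empty_iff]
          rintro i - rfl
          exact ha (Finset.mem_map.2 ⟨j' i, Finset.mem_univ _, hj' i⟩)
        rw [this, Finset.range_zero, Finset.prod_empty]
    have h := fallingCount_of_surjective hP hk (fun p => hA (emb p))
      (fun p q hpq => hd (emb.injective.ne hpq)) hsurj
    rw [hcount]
    simpa only [hj'] using h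

/-- A step function that is constant on finitely many disjoint compact subsets of `B` and vanishes
elsewhere, with values in `[-C, C]`. -/
def IsCompactStep (B : Set X) (C : ℝ) (g : X → ℝ) : Prop :=
  ∃ (ι : Type) (_ : Fintype ι) (A : ι → Set X) (c : ι → ℝ), (∀ a, IsCompact (A a)) ∧
    (∀ a, A a ⊆ B) ∧ (Pairwise fun a b => Disjoint (A a) (A b)) ∧ (∀ a, |c a| ≤ C) ∧
    (∀ a, ∀ x ∈ A a, g x = c a) ∧ ∀ x, (∀ a, x ∉ A a) → g x = 0

theorem linearStatistic_of_step {ι : Type*} [Fintype ι] {A : ι → Set X} {c : ι → ℝ} {g : X → ℝ}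
    (hA : ∀ a, IsCompact (A a)) (hd : Pairwise fun a b => Disjoint (A a) (A b))
    (hg : ∀ a, ∀ x ∈ A a, g x = c a) (hg0 : ∀ x, (∀ a, x ∉ A a) → g x = 0) (ξ : Conf X) :
    Conf.linearStatistic g ξ = ∑ a, c a * ξ.count (A a) := by
  rw [Conf.linearStatistic, step_eq_sum_indicator hd hg hg0, integral_finsetSum]
  · refine Finset.sum_congr rfl fun a _ => ?_
    rw [integral_indicator_const _ (hA a).measurableSet, smul_eq_mul, mul_comm, Conf.count]
  · intro a _
    exact (integrable_indicator_iff (hA a).measurableSet).2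
      (integrableOn_const (ξ.lt_top_of_isCompact _ (hA a)).ne)

/-- For a step function the statistic is a weighted sum of integer counts. Its powers expand into
falling factorials, whose expectations are integrals of Pfaffians over products of the sets `A a`.
-/
theorem integral_linearStatistic_pow_of_isCompactStep (hP : IsPfaffianPointProcess P μ K)
    [IsLocallyFiniteMeasure μ] {B : Set X} (hB : IsCompact B) {C : ℝ} {g : X → ℝ}
    (hg : IsCompactStep B C g) (n : ℕ) :
    ((∫ ξ, Conf.linearStatistic g ξ ^ n ∂P : ℝ) : ℂ) / (n.factorial : ℂ) =
      PowerSeries.coeff n (momentSeries K (μ.restrict B) (expSubOne g)) := by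
  classical
  obtain ⟨ι, _, A, c, hA, hAB, hd, -, hgA, hg0⟩ := hg
  have hS : ∀ ξ : Conf X, (((Conf.linearStatistic g ξ) ^ n : ℝ) : ℂ) / (n.factorial : ℂ) =
      ∑ k ∈ Finset.range (n + 1), 1 / (k.factorial : ℂ) * ∑ j : Fin k → ι,
        PowerSeries.coeff n (∏ i, expSubOne id (c (j i))) *
          ((fallingCount A (fiberCard j) ξ : ℝ) : ℂ) := by
    intro ξ
    choose N hN using fun a => ξ.exists_count_eq_natCast (hA a).measurableSet
      (ξ.lt_top_of_isCompact _ (hA a)).ne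
    have h := sum_pow_div_factorial N id c n
    rw [linearStatistic_of_step hA hd hgA hg0]
    simp only [fallingCount, hN, prod_range_cast_sub]
    push_cast at h ⊢
    exact h
  have hint := fun (k : ℕ) (j : Fin k → ι) => fallingCount_fiberCard hP hA hd j
  rw [← integral_complex_ofReal, ← integral_div]
  simp only [hS]
  rw [integral_finsetSum _ fun k _ => (integrable_finsetSum _ fun j _ =>
    ((hint k j).1.ofReal.const_mul _)).const_mul _, momentSeries, PowerSeries.coeff_mk]
  refine Finset.sum_congr rfl fun k _ => ?_
  rw [integral_const_mul, PowerSeries.coeff_smul, smul_eq_mul, pfaffianSeries,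
    coeff_coeffIntegral]
  congr 1
  have hR : ∀ j : Fin k → ι, MeasurableSet {x : Fin k → X | ∀ i, x i ∈ A (j i)} := fun j => by
    have : {x : Fin k → X | ∀ i, x i ∈ A (j i)} = Set.univ.pi fun i => A (j i) := by
      ext x; simp
    rw [this]
    exact MeasurableSet.univ_pi fun i => (hA _).measurableSet
  have hPk := integrable_kernelPfaffian hP hB k
  have h2 : ∀ (x : Fin k → X) (j : Fin k → ι),
      PowerSeries.coeff n (∏ i, expSubOne id (c (j i))) *
        {x : Fin k → X | ∀ i, x i ∈ A (j i)}.indicator (fun _ => (1 : ℂ)) x *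
          kernelPfaffian K x = PowerSeries.coeff n (∏ i, expSubOne id (c (j i))) *
        {x : Fin k → X | ∀ i, x i ∈ A (j i)}.indicator (kernelPfaffian K) x := by
    intro x j
    rw [mul_assoc]
    congr 1
    by_cases h : x ∈ {x : Fin k → X | ∀ i, x i ∈ A (j i)}
    · rw [Set.indicator_of_mem h, Set.indicator_of_mem h, one_mul]
    · rw [Set.indicator_of_notMem h, Set.indicator_of_notMem h, zero_mul]
  simp only [expSubOne_of_step hd hgA hg0, Finset.sum_mul, h2]
  rw [integral_finsetSum _ fun j _ => (hint k j).1.ofReal.const_mul _,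
    integral_finsetSum _ fun j _ => (hPk.indicator (hR j)).const_mul _]
  refine Finset.sum_congr rfl fun j _ => ?_
  rw [integral_const_mul, integral_const_mul]
  congr 1
  have h3 : (∫ ξ, ((fallingCount A (fiberCard j) ξ : ℝ) : ℂ) ∂P) =
      ((∫ ξ, fallingCount A (fiberCard j) ξ ∂P : ℝ) : ℂ) := integral_complex_ofReal
  refine h3.trans ?_
  rw [(hint k j).2, integral_indicator (hR j), ← Measure.restrict_pi_pi,
    Measure.restrict_restrict (hR j), Set.inter_eq_left.2]
  intro x hx i _
  exact hAB _ (hx i)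

end FactorialMoments

/-! ### Approximation by step functions on disjoint compact sets -/

section CompactSteps

variable {X : Type*} [TopologicalSpace X] {B : Set X} {C : ℝ} {g : X → ℝ}

theorem IsCompactStep.eq_zero (hg : IsCompactStep B C g) {x : X} (hx : x ∉ B) : g x = 0 := by
  obtain ⟨ι, _, A, c, -, hAB, -, -, -, hg0⟩ := hg
  exact hg0 x fun a ha => hx (hAB a ha)

theorem IsCompactStep.abs_le (hg : IsCompactStep B C g) (hC : 0 ≤ C) (x : X) : |g x| ≤ C := by
  obtain ⟨ι, _, A, c, -, -, -, hc, hgA, hg0⟩ := hg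
  by_cases hx : ∃ a, x ∈ A a
  · obtain ⟨a, ha⟩ := hx
    rw [hgA a x ha]
    exact hc a
  · push Not at hx
    rwa [hg0 x hx, abs_zero]

theorem IsCompactStep.measurable [T2Space X] [MeasurableSpace X] [OpensMeasurableSpace X]
    (hg : IsCompactStep B C g) : Measurable g := by
  obtain ⟨ι, _, A, c, hA, -, hd, -, hgA, hg0⟩ := hg
  rw [step_eq_sum_indicator hd hgA hg0]
  exact Finset.measurable_fun_sum _ fun a _ => measurable_const.indicator (hA a).measurableSet

theorem exists_isCompactStep_measure_le [PolishSpace X] [MeasurableSpace X] [BorelSpace X]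
    (lam : Measure X) [IsFiniteMeasure lam] (hB : MeasurableSet B) (s : SimpleFunc X ℝ)
    (hs : ∀ x, |s x| ≤ C) {ε : ℝ≥0∞} (hε : ε ≠ 0) :
    ∃ g : X → ℝ, IsCompactStep B C g ∧ lam {x | x ∈ B ∧ g x ≠ s x} ≤ ε := by
  classical
  -- Each level set in `B` loses mass less than `ε / N`; the added `1` keeps `N` nonzero.
  set N : ℝ≥0∞ := (s.range.card : ℝ≥0∞) + 1 with hN
  have hN0 : N ≠ 0 := by simp [hN]
  have hNtop : N ≠ ∞ := by simp [hN]
  have hδ : ε / N ≠ 0 := ENNReal.div_ne_zero.2 ⟨hε, hNtop⟩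
  have hex : ∀ y : s.range, ∃ A ⊆ s ⁻¹' {(y : ℝ)} ∩ B, IsCompact A ∧
      lam ((s ⁻¹' {(y : ℝ)} ∩ B) \ A) < ε / N := fun y =>
    ((s.measurableSet_preimage _).inter hB).exists_isCompact_sdiff_lt (measure_ne_top _ _) hδ
  choose A hAsub hA hAlt using hex
  have hAs : ∀ y, ∀ x ∈ A y, s x = y := fun y x hx => (hAsub y hx).1
  refine ⟨fun x => if ∃ y, x ∈ A y then s x else 0, ⟨s.range, inferInstance, A, fun y => y, hA,
    fun y x hx => (hAsub y hx).2, fun y z hyz => ?_, fun y => ?_, fun y x hx => ?_,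
    fun x hx => ?_⟩, ?_⟩
  · refine Set.disjoint_left.2 fun x hy hz => ?_
    exact hyz (Subtype.ext ((hAs y x hy).symm.trans (hAs z x hz)))
  · obtain ⟨x, hx⟩ := SimpleFunc.mem_range.1 y.2
    change |(y : ℝ)| ≤ C
    rw [← hx]
    exact hs x
  · change (if ∃ y, x ∈ A y then s x else 0) = (y : ℝ)
    rw [if_pos ⟨y, hx⟩, hAs y x hx]
  · exact if_neg (by push Not; exact hx)
  · have hsub : {x | x ∈ B ∧ (if ∃ y, x ∈ A y then s x else 0) ≠ s x} ⊆
        ⋃ y : s.range, (s ⁻¹' {(y : ℝ)} ∩ B) \ A y := by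
      rintro x ⟨hxB, hx⟩
      rw [Set.mem_iUnion]
      refine ⟨⟨s x, s.mem_range_self x⟩, ⟨rfl, hxB⟩, fun hxA => hx ?_⟩
      rw [if_pos ⟨_, hxA⟩]
    calc lam {x | x ∈ B ∧ (if ∃ y, x ∈ A y then s x else 0) ≠ s x}
        ≤ lam (⋃ y : s.range, (s ⁻¹' {(y : ℝ)} ∩ B) \ A y) := measure_mono hsub
      _ ≤ ∑ y : s.range, lam ((s ⁻¹' {(y : ℝ)} ∩ B) \ A y) := measure_iUnion_fintype_le _ _
      _ ≤ ∑ _y : s.range, ε / N := Finset.sum_le_sum fun y _ => (hAlt y).le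
      _ = s.range.card * (ε / N) := by simp
      _ ≤ N * (ε / N) := by gcongr; exact le_self_add
      _ = ε := ENNReal.mul_div_cancel hN0 hNtop

/-- Simple functions with values in `[-C, C]` converge to `f` everywhere. Replacing the `i`-th by a
compact step costs mass at most `2^(-i)`, so by Borel–Cantelli almost every point of `B` is affected
only finitely often. -/
theorem exists_isCompactStep_tendsto [PolishSpace X] [MeasurableSpace X] [BorelSpace X]
    (lam : Measure X) [IsFiniteMeasure lam] (hB : MeasurableSet B) {f : X → ℝ} (hf : Measurable f)
    (hC : 0 ≤ C) (hfC : ∀ x, |f x| ≤ C) :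
    ∃ F : ℕ → X → ℝ, (∀ i, IsCompactStep B C (F i)) ∧
      ∀ᵐ x ∂lam, x ∈ B → Tendsto (fun i => F i x) atTop (𝓝 (f x)) := by
  have h0 : (0 : ℝ) ∈ Set.Icc (-C) C := ⟨neg_nonpos.2 hC, hC⟩
  set s : ℕ → SimpleFunc X ℝ := SimpleFunc.approxOn f hf (Set.Icc (-C) C) 0 h0 with hs
  have hsC : ∀ i x, |s i x| ≤ C := fun i x => abs_le.2 (SimpleFunc.approxOn_mem hf h0 i x)
  have hst : ∀ x, Tendsto (fun i => s i x) atTop (𝓝 (f x)) := fun x =>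
    SimpleFunc.tendsto_approxOn hf h0 (subset_closure (abs_le.1 (hfC x)))
  have hε : ∀ i : ℕ, (2⁻¹ : ℝ≥0∞) ^ i ≠ 0 := fun i => pow_ne_zero _ (by simp)
  choose F hF hFs using fun i => exists_isCompactStep_measure_le lam hB (s i) (hsC i) (hε i)
  refine ⟨F, hF, ?_⟩
  have hsum : ∑' i, lam {x | x ∈ B ∧ F i x ≠ s i x} ≠ ∞ := by
    refine ne_top_of_le_ne_top ?_ (ENNReal.tsum_le_tsum hFs)
    rw [ENNReal.tsum_geometric, ENNReal.one_sub_inv_two, inv_inv]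
    exact ENNReal.ofNat_ne_top
  filter_upwards [ae_eventually_notMem hsum] with x hx hxB
  refine (hst x).congr' ?_
  filter_upwards [hx] with i hi
  by_contra h
  exact hi ⟨hxB, fun h' => h h'.symm⟩

end CompactSteps

/-! ### Bounds and limits for statistics and moment series -/

theorem Conf.linearStatistic_eq_setIntegral {X : Type*} [TopologicalSpace X] [MeasurableSpace X]
    {f : X → ℝ} {B : Set X} (hfB : ∀ x, x ∉ B → f x = 0) (ξ : Conf X) :
    ξ.linearStatistic f = ∫ x in B, f x ∂ξ.toMeasure :=
  (setIntegral_eq_integral_of_forall_compl_eq_zero hfB).symm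

theorem Conf.abs_linearStatistic_le {X : Type*} [TopologicalSpace X] [MeasurableSpace X]
    {f : X → ℝ} {B : Set X} (hB : IsCompact B) {C : ℝ}
    (hfC : ∀ x, |f x| ≤ C) (hfB : ∀ x, x ∉ B → f x = 0) (ξ : Conf X) :
    |ξ.linearStatistic f| ≤ C * ξ.count B := by
  rw [linearStatistic_eq_setIntegral hfB, ← Real.norm_eq_abs]
  exact norm_setIntegral_le_of_norm_le_const (f := f) (C := C) (ξ.lt_top_of_isCompact _ hB)
    fun x _ => (Real.norm_eq_abs _).trans_le (hfC x)

theorem boundedCoeffs_expSubOne {α : Type*} [MeasurableSpace α] {f : α → ℝ} (hf : Measurable f)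
    {C : ℝ} (hfC : ∀ x, |f x| ≤ C) : BoundedCoeffs (expSubOne f) := by
  intro n
  simp only [coeff_expSubOne]
  refine ⟨((Complex.measurable_ofReal.comp hf).pow_const n).const_mul _,
    ‖expSubOneCoeff n‖ * C ^ n, fun x => ?_⟩
  rw [norm_mul, norm_pow, Complex.norm_real]
  gcongr
  exact hfC x

theorem coeff_prod_expSubOne {α : Type*} (f : α → ℝ) {k : ℕ} (x : Fin k → α) (n : ℕ) :
    PowerSeries.coeff n (∏ i, expSubOne f (x i)) = ∑ l ∈ Finset.univ.piAntidiag n,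
      ∏ i, (expSubOneCoeff (l i) * (f (x i) : ℂ) ^ l i) := by
  simp only [coeff_univ_prod, coeff_expSubOne]

theorem norm_coeff_prod_expSubOne_le {α : Type*} {f : α → ℝ} {C : ℝ} (hfC : ∀ x, |f x| ≤ C)
    {k : ℕ} (x : Fin k → α) (n : ℕ) : ‖PowerSeries.coeff n (∏ i, expSubOne f (x i))‖ ≤
      ∑ l ∈ (Finset.univ : Finset (Fin k)).piAntidiag n, ∏ i, (‖expSubOneCoeff (l i)‖ * C ^ l i) := by
  rw [coeff_prod_expSubOne]
  refine (norm_sum_le _ _).trans (Finset.sum_le_sum fun l _ => ?_)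
  rw [norm_prod]
  refine Finset.prod_le_prod (fun _ _ => norm_nonneg _) fun i _ => ?_
  rw [norm_mul, norm_pow, Complex.norm_real]
  gcongr
  exact hfC _

theorem tendsto_coeff_momentSeries {X : Type*} [TopologicalSpace X] [PolishSpace X]
    [MeasurableSpace X] {μ : Measure X} [IsLocallyFiniteMeasure μ] {P : Measure (Conf X)}
    {K : X → X → Matrix (Fin 2) (Fin 2) ℂ} {B : Set X}
    (hP : IsPfaffianPointProcess P μ K) (hB : IsCompact B) {C : ℝ}
    {F : ℕ → X → ℝ} (hF : ∀ i, Measurable (F i)) (hFC : ∀ i x, |F i x| ≤ C) {f : X → ℝ}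
    (hlim : ∀ᵐ x ∂(μ.restrict B), Tendsto (fun i => F i x) atTop (𝓝 (f x))) (n : ℕ) :
    Tendsto (fun i => PowerSeries.coeff n (momentSeries K (μ.restrict B) (expSubOne (F i)))) atTop
      (𝓝 (PowerSeries.coeff n (momentSeries K (μ.restrict B) (expSubOne f)))) := by
  simp only [momentSeries, PowerSeries.coeff_mk, PowerSeries.coeff_smul, smul_eq_mul,
    pfaffianSeries, coeff_coeffIntegral]
  refine tendsto_finsetSum _ fun k _ => Tendsto.const_mul _ ?_
  have hPk := integrable_kernelPfaffian hP hB k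
  refine tendsto_integral_of_dominated_convergence
    (fun x => (∑ l ∈ (Finset.univ : Finset (Fin k)).piAntidiag n,
      ∏ i, (‖expSubOneCoeff (l i)‖ * C ^ l i)) * ‖kernelPfaffian K x‖) (fun i => ?_)
    (hPk.norm.const_mul _) (fun i => ae_of_all _ fun x => ?_) ?_
  · exact (((boundedCoeffs_expSubOne (hF i) (hFC i)).pi_prod k).integrable_mul hPk n).1
  · rw [norm_mul]
    gcongr
    exact norm_coeff_prod_expSubOne_le (hFC i) x n
  · have hall : ∀ᵐ x ∂(Measure.pi fun _ : Fin k => μ.restrict B),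
        ∀ j, Tendsto (fun i => F i (x j)) atTop (𝓝 (f (x j))) :=
      ae_all_iff.2 fun j =>
        (Measure.tendsto_eval_ae_ae (μ := fun _ : Fin k => μ.restrict B) (i := j)).eventually hlim
    filter_upwards [hall] with x hx
    simp only [coeff_prod_expSubOne]
    refine Tendsto.mul_const _ (tendsto_finsetSum _ fun l _ => tendsto_finsetProd _ fun j _ => ?_)
    exact (((Complex.continuous_ofReal.tendsto _).comp (hx j)).pow _).const_mul _

/-! ### Finiteness of moments and the moment formula for bounded measurable functions -/

section Moments

variable {X : Type*} [TopologicalSpace X] [PolishSpace X] [LocallyCompactSpace X]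
  [MeasurableSpace X] [BorelSpace X]

theorem Conf.measurable_toMeasure : Measurable fun ξ : Conf X => ξ.toMeasure :=
  Measure.measurable_of_measurable_coe _ fun _ hA => Conf.measurable_apply hA

theorem Conf.measurable_linearStatistic {f : X → ℝ} (hf : Measurable f) :
    Measurable (Conf.linearStatistic f) := by
  let κ : Kernel (Conf X) X := ⟨fun ξ => ξ.toMeasure, Conf.measurable_toMeasure⟩
  exact (StronglyMeasurable.integral_kernel (κ := κ) hf.stronglyMeasurable).measurable

theorem Conf.measurable_count {A : Set X} (hA : MeasurableSet A) :
    Measurable fun ξ : Conf X => ξ.count A :=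
  (Conf.measurable_apply hA).ennreal_toReal

variable {μ : Measure X} [IsLocallyFiniteMeasure μ] {P : Measure (Conf X)}
  {K : X → X → Matrix (Fin 2) (Fin 2) ℂ} {B : Set X}

theorem integrable_count_pow (hP : IsPfaffianPointProcess P μ K) (hB : IsCompact B) (p : ℕ) :
    Integrable (fun ξ : Conf X => ξ.count B ^ p) P := by
  have := hP.isProbabilityMeasure
  have h1 := (fallingCount_fiberCard hP (A := fun _ : Unit => B) (fun _ => hB)
    (fun a b hab => (hab (Subsingleton.elim a b)).elim) (k := p) fun _ => ()).1
  have hmeas : Measurable fun ξ : Conf X => ξ.count B ^ p :=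
    (Conf.measurable_count hB.measurableSet).pow_const p
  refine ((integrable_const ((2 * p : ℝ) ^ p)).add (h1.const_mul (2 ^ p))).mono'
    hmeas.aestronglyMeasurable (ae_of_all _ fun ξ => ?_)
  obtain ⟨N, hN⟩ := ξ.exists_count_eq_natCast hB.measurableSet (ξ.lt_top_of_isCompact _ hB).ne
  have h2 : fallingCount (fun _ : Unit => B) (fiberCard fun _ : Fin p => ()) ξ =
      (N.descFactorial p : ℝ) := by
    simp [fallingCount, fiberCard, hN, ← prod_range_cast_sub]
  rw [Pi.add_apply, h2, hN, Real.norm_of_nonneg (by positivity)]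
  exact pow_le_add_descFactorial N p

theorem integrable_mul_count_pow (hP : IsPfaffianPointProcess P μ K) (hB : IsCompact B) (C : ℝ)
    (p : ℕ) : Integrable (fun ξ : Conf X => (C * ξ.count B) ^ p) P := by
  simp only [mul_pow]
  exact (integrable_count_pow hP hB p).const_mul _

theorem memLp_linearStatistic (hP : IsPfaffianPointProcess P μ K) (hB : IsCompact B) {C : ℝ}
    {f : X → ℝ} (hf : Measurable f) (hfC : ∀ x, |f x| ≤ C) (hfB : ∀ x, x ∉ B → f x = 0) (p : ℕ) :
    MemLp (Conf.linearStatistic f) (p : ℝ≥0∞) P := by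
  have hm := (Conf.measurable_linearStatistic hf).aestronglyMeasurable (μ := P)
  rcases Nat.eq_zero_or_pos p with rfl | hp
  · simpa using hm
  · rw [← integrable_norm_rpow_iff hm (by exact_mod_cast hp.ne') (by simp)]
    simp only [ENNReal.toReal_natCast, Real.rpow_natCast]
    refine (integrable_mul_count_pow hP hB C p).mono'
      (hm.norm.pow p) (ae_of_all _ fun ξ => ?_)
    rw [norm_pow, norm_norm]
    exact pow_le_pow_left₀ (norm_nonneg _) (Conf.abs_linearStatistic_le hB hfC hfB ξ) p

/-- Dominated convergence is used twice: for fixed `ξ` with the constant `C` on `B`, then under `P`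
with `(C ξ(B))^n`. -/
theorem tendsto_integral_linearStatistic_pow (hP : IsPfaffianPointProcess P μ K)
    (hB : IsCompact B) {C : ℝ} {F : ℕ → X → ℝ} (hF : ∀ i, Measurable (F i))
    (hFC : ∀ i x, |F i x| ≤ C) (hFB : ∀ i x, x ∉ B → F i x = 0) {f : X → ℝ}
    (hfB : ∀ x, x ∉ B → f x = 0)
    (hlim : ∀ᵐ ξ ∂P, ∀ᵐ x ∂(ξ.toMeasure.restrict B), Tendsto (fun i => F i x) atTop (𝓝 (f x)))
    (n : ℕ) :
    Tendsto (fun i => ∫ ξ, Conf.linearStatistic (F i) ξ ^ n ∂P) atTop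
      (𝓝 (∫ ξ, Conf.linearStatistic f ξ ^ n ∂P)) := by
  refine tendsto_integral_of_dominated_convergence (fun ξ => (C * ξ.count B) ^ n) (fun i => ?_)
    (integrable_mul_count_pow hP hB C n) (fun i => ae_of_all _ fun ξ => ?_) ?_
  · exact ((Conf.measurable_linearStatistic (hF i)).pow_const n).aestronglyMeasurable
  · rw [norm_pow]
    exact pow_le_pow_left₀ (norm_nonneg _) (Conf.abs_linearStatistic_le hB (hFC i) (hFB i) ξ) n
  · filter_upwards [hlim] with ξ hξ
    refine Tendsto.pow ?_ n
    simp only [Conf.linearStatistic_eq_setIntegral (hFB _), Conf.linearStatistic_eq_setIntegral hfB]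
    have : IsFiniteMeasure (ξ.toMeasure.restrict B) :=
      isFiniteMeasure_restrict.2 (ξ.lt_top_of_isCompact _ hB).ne
    exact tendsto_integral_of_dominated_convergence (fun _ => C)
      (fun i => (hF i).aestronglyMeasurable) (integrable_const _)
      (fun i => ae_of_all _ fun x => hFC i x) hξ

theorem integral_linearStatistic_pow (hP : IsPfaffianPointProcess P μ K) (hB : IsCompact B)
    {C : ℝ} (hC : 0 ≤ C) {f : X → ℝ} (hf : Measurable f) (hfC : ∀ x, |f x| ≤ C)
    (hfB : ∀ x, x ∉ B → f x = 0) (n : ℕ) :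
    ((∫ ξ, Conf.linearStatistic f ξ ^ n ∂P : ℝ) : ℂ) / (n.factorial : ℂ) =
      PowerSeries.coeff n (momentSeries K (μ.restrict B) (expSubOne f)) := by
  have hmeas : Measurable fun ξ : Conf X => ξ.toMeasure.restrict B :=
    Measure.measurable_of_measurable_coe _ fun s hs => by
      simp only [Measure.restrict_apply hs]
      exact Conf.measurable_apply (hs.inter hB.measurableSet)
  -- The intensity measure on `B`: an `I`-null set is null for `ξ` restricted to `B`, for `P`-almost
  -- every `ξ`. Approximating with respect to `I + μ.restrict B` gives one sequence that serves both
  -- sides of the identity.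
  set I : Measure X := P.bind fun ξ => ξ.toMeasure.restrict B with hI
  have hIfin : IsFiniteMeasure I := by
    refine ⟨?_⟩
    rw [hI, Measure.bind_apply MeasurableSet.univ hmeas.aemeasurable]
    have h1 := (integrable_count_pow hP hB 1).lintegral_lt_top
    refine lt_of_le_of_lt (lintegral_mono fun ξ => ?_) h1
    rw [Measure.restrict_apply_univ, pow_one, Conf.count, Measure.real,
      ENNReal.ofReal_toReal (ξ.lt_top_of_isCompact _ hB).ne]
  have hμfin : IsFiniteMeasure (μ.restrict B) :=
    isFiniteMeasure_restrict.2 hB.measure_lt_top.ne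
  obtain ⟨F, hF, hlim⟩ :=
    exists_isCompactStep_tendsto (I + μ.restrict B) hB.measurableSet hf hC hfC
  rw [ae_add_measure_iff] at hlim
  have hlim1 : ∀ᵐ ξ ∂P, ∀ᵐ x ∂(ξ.toMeasure.restrict B),
      Tendsto (fun i => F i x) atTop (𝓝 (f x)) := by
    filter_upwards [Measure.ae_ae_of_ae_bind hmeas.aemeasurable hlim.1] with ξ hξ
    filter_upwards [hξ, ae_restrict_mem hB.measurableSet] with x hx hxB using hx hxB
  have hlim2 : ∀ᵐ x ∂(μ.restrict B), Tendsto (fun i => F i x) atTop (𝓝 (f x)) := by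
    filter_upwards [hlim.2, ae_restrict_mem hB.measurableSet] with x hx hxB using hx hxB
  have hFm := fun i => (hF i).measurable
  have hFC := fun i => (hF i).abs_le hC
  have hFB := fun i x hx => (hF i).eq_zero (x := x) hx
  have h1 := tendsto_integral_linearStatistic_pow hP hB hFm hFC hFB hfB hlim1 n
  have h2 := tendsto_coeff_momentSeries hP hB hFm hFC hlim2 n
  have h3 := ((Complex.continuous_ofReal.tendsto _).comp h1).div_const (n.factorial : ℂ)
  refine tendsto_nhds_unique (h3.congr fun i => ?_) h2
  exact integral_linearStatistic_pow_of_isCompactStep hP hB (hF i) n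

end Moments

end

theorem proposition2p2 {X : Type*} [TopologicalSpace X] [PolishSpace X] [LocallyCompactSpace X]
    [MeasurableSpace X] [BorelSpace X] (μ : Measure X) [IsLocallyFiniteMeasure μ]
    (P : Measure (Conf X)) (K : X → X → Matrix (Fin 2) (Fin 2) ℂ)
    (hP : IsPfaffianPointProcess P μ K)
    (f : X → ℝ) (hf_meas : Measurable f) (hf_bdd : ∃ C : ℝ, ∀ x, |f x| ≤ C)
    (hf_supp : HasCompactSupport f) (n : ℕ) (hn : 0 < n)
    (h_int : ∀ c : Composition n,
      Integrable (cumulantIntegrand f K c.blocksFun) (Measure.pi fun _ : Fin c.length => μ)) :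
    (∀ p : ℕ, MemLp (Conf.linearStatistic f) (p : ℝ≥0∞) P) ∧
    cumulant P (Conf.linearStatistic f) n =
      1 / 2 * ∑ c : Composition n,
        (-1 : ℂ) ^ (c.length - 1) *
          ((n.factorial : ℂ) / ∏ i : Fin c.length, ((c.blocksFun i).factorial : ℂ)) *
          (1 / (c.length : ℂ)) *
          ∫ x, cumulantIntegrand f K c.blocksFun x ∂(Measure.pi fun _ : Fin c.length => μ) := by
  have := hP.isProbabilityMeasure
  obtain ⟨C, hC⟩ := hf_bdd
  -- The bound must be nonnegative, which `C` need not be when `X` is empty.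
  have hfC : ∀ x, |f x| ≤ max C 0 := fun x => (hC x).trans (le_max_left _ _)
  have hB : IsCompact (tsupport f) := hf_supp
  have hfB : ∀ x, x ∉ tsupport f → f x = 0 := fun x hx => image_eq_zero_of_notMem_tsupport hx
  have hmom := memLp_linearStatistic hP hB hf_meas hfC hfB
  refine ⟨hmom, ?_⟩
  have hA := kernelForm_antisymm hP.symm_diag hP.antisymm_upper hP.antisymm_lower
  rw [cumulant_eq_of_eulerDeriv_eq (Conf.measurable_linearStatistic hf_meas) hmom
    (fun m => (integral_linearStatistic_pow hP hB (le_max_right C 0) hf_meas hfC hfB m).symm)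
    (eulerDeriv_momentSeries hA (integrable_kernelPfaffian hP hB)
      (boundedCoeffs_expSubOne hf_meas hfC) (X_dvd_expSubOne f)) hn]
  rw [coeff_cumulantSeries hn]
  · congr 1
    refine Finset.sum_congr rfl fun c _ => ?_
    congr 1
    -- The computation took place over the support of `f`. As every exponent is positive, the
    -- integrand vanishes once a coordinate leaves the support, so the restriction can be dropped.
    rw [← Measure.restrict_pi_pi]
    refine setIntegral_eq_integral_of_forall_compl_eq_zero fun x hx => ?_
    rw [Set.mem_univ_pi] at hx
    push Not at hx
    obtain ⟨i, hi⟩ := hx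
    rw [cumulantIntegrand, Finset.prod_eq_zero (Finset.mem_univ i), zero_mul]
    rw [hfB _ hi, Complex.ofReal_zero, zero_pow (Nat.one_le_iff_ne_zero.1 (c.one_le_blocksFun i))]
  · intro c
    rw [← Measure.restrict_pi_pi]
    exact (h_int c).restrict
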